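/- **Setting.** Let $\Lambda=\Lambda_0\oplus\Lambda_1$ be a Banach commutative superalgebra over $\mathbb C$ (for example a Grassmann algebra). A smooth superfunction is $u(x,\theta)=u^0(x)+\theta u^1(x)$ with $u^0,u^1\in C^\infty(\mathbb R/2\pi\mathbb Z;\Lambda)$, $\theta^2=0$, $\theta$ odd; $p(u)$ is its parity. Let $D_\theta=\partial_\theta+\theta\partial_x$, so $D_\theta^2=\partial=\partial_x$, and on superfunctions let $D_\theta^{-1}(u^0+\theta u^1)=\partial^{-1}u^1+\theta u^0$, where $\partial^{-1}v$ is the antiderivative of mean value zero of $v-\overline v$ ($\overline v$ the mean value of $v$). Let $\mathcal G$ be the Lie algebra of even formal operators $a=\sum_{j\le m}a_jD_\theta^j$ ($m\in\mathbb Z$, $p(a_j)\equiv j$ mod $2$), with the associative product $\circ$ determined by $D_\theta\circ u=(D_\theta u)+(-1)^{p(u)}uD_\theta$, commutator $[a,b]=a\circ b-b\circ a$, $a_+=\sum_{j\ge0}a_jD_\theta^j$, and $(a,b)=\int_0^{2\pi}dx\int d\theta\,\operatorname{res}(a\circ b)$, $\operatorname{res}a=a_{-1}$, $\int d\theta\,(u^0+\theta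 u^1)=u^1$. Eigenfunctions $w$ and adjoint eigenfunctions $w^*$ (of opposite parities) are paired by $\langle w,w^*\rangle=\int_0^{2\pi}dx\int d\theta\,\operatorname{res}(wD_\theta^{-1}w^*)=(-1)^{p(w^*)}\int_0^{2\pi}dx\int d\theta\,ww^*$; $A^*$ is the adjoint, $\langle Aw,w^*\rangle=\langle w,A^*w^*\rangle$, so that $(aD_\theta^j)^*=(-1)^{j(j-1)/2}D_\theta^j\circ a$ if $p(a)\equiv j$ mod $2$, and $(uD_\theta^{-1}v)^*=-vD_\theta^{-1}u$ if $uD_\theta^{-1}v$ is even. **Phase space.** Points are $(l_+,f_i,\Phi_i^*,f_i^*,\Phi_i)_{i=1}^N$ with $l_+=\sum_{j=0}^{n}a_jD_\theta^j\in\mathcal G$ a differential operator of any finite order, $f_i,\Phi_i^*$ even and $f_i^*,\Phi_i$ odd smooth superfunctions. Put $\tilde l=l_+$ and $$l=l_++\sum_{i=1}^N\bigl(f_iD_\theta^{-1}f_i^*+\Phi_iD_\theta^{-1}\Phi_i^*\bigr);$$ $(l,f_i,\Phi_i^*,f_i^*,\Phi_i)$ are the new coordinates. A gradient $\nabla\gamma=\bigl(\frac{\delta\gamma}{\delta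 l},\frac{\delta\gamma}{\delta f_i},\frac{\delta\gamma}{\delta\Phi_i^*},\frac{\delta\gamma}{\delta f_i^*},\frac{\delta\gamma}{\delta\Phi_i}\bigr)$ of a $\Lambda$-valued functional $\gamma$ at a point consists of $\frac{\delta\gamma}{\delta l}\in\mathcal G$ and of smooth superfunctions of parity opposite to that of the respective variables, such that along every direction tangent to the phase space $$\delta\gamma=\Bigl(\tfrac{\delta\gamma}{\delta l},\delta l\Bigr)+\sum_{i=1}^N\Bigl(\bigl\langle\delta f_i,\tfrac{\delta\gamma}{\delta f_i}\bigr\rangle+\bigl\langle\tfrac{\delta\gamma}{\delta\Phi_i^*},\delta\Phi_i^*\bigr\rangle+\bigl\langle\tfrac{\delta\gamma}{\delta f_i^*},\delta f_i^*\bigr\rangle+\bigl\langle\delta\Phi_i,\tfrac{\delta\gamma}{\delta\Phi_i}\bigr\rangle\Bigr).$$ The Poisson structure is $$\mathcal L:\nabla\gamma\mapsto\begin{pmatrix}\bigl[\tilde l,(\frac{\delta\gamma}{\delta l})_+\bigr]-\bigl[\tilde l,\frac{\delta\gamma}{\delta l}\bigr]_++\sum_{i}\bigl(f_iD_\theta^{-1}\frac{\delta\gamma}{\delta\tilde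 f_i}-\frac{\delta\gamma}{\delta\tilde f_i^*}D_\theta^{-1}f_i^*+\Phi_iD_\theta^{-1}\frac{\delta\gamma}{\delta\tilde\Phi_i}-\frac{\delta\gamma}{\delta\tilde\Phi_i^*}D_\theta^{-1}\Phi_i^*\bigr)\\-\frac{\delta\gamma}{\delta f_i^*}-(\frac{\delta\gamma}{\delta l})_+f_i\\ \frac{\delta\gamma}{\delta\Phi_i}+(\frac{\delta\gamma}{\delta l})_+^*\Phi_i^*\\ \frac{\delta\gamma}{\delta f_i}+(\frac{\delta\gamma}{\delta l})_+^*f_i^*\\-\frac{\delta\gamma}{\delta\Phi_i^*}-(\frac{\delta\gamma}{\delta l})_+\Phi_i\end{pmatrix},$$ where the gradients in the variables with tildes are $\frac{\delta\gamma}{\delta\tilde f_i}=\frac{\delta\gamma}{\delta f_i}+(\frac{\delta\gamma}{\delta l})_+^*f_i^*$, $\frac{\delta\gamma}{\delta\tilde f_i^*}=\frac{\delta\gamma}{\delta f_i^*}+(\frac{\delta\gamma}{\delta l})_+f_i$, $\frac{\delta\gamma}{\delta\tilde\Phi_i}=\frac{\delta\gamma}{\delta\Phi_i}+(\frac{\delta\gamma}{\delta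 l})_+^*\Phi_i^*$, $\frac{\delta\gamma}{\delta\tilde\Phi_i^*}=\frac{\delta\gamma}{\delta\Phi_i^*}+(\frac{\delta\gamma}{\delta l})_+\Phi_i$. The Hamiltonian system of $\gamma$ is $\frac{d}{d\tau}(l,f_i,\Phi_i^*,f_i^*,\Phi_i)^T=-\mathcal L\nabla\gamma$. **Theorem.** For every $k=1,\dots,N$ and $s\in\mathbb N$ let $$M_k^s=\sum_{p=0}^{s-1}\bigl((l^pf_k)D_\theta^{-1}(l^{*\,s-1-p}f_k^*)+(l^p\Phi_k)D_\theta^{-1}(l^{*\,s-1-p}\Phi_k^*)\bigr),\qquad\lambda_k^s=\langle l^sf_k,f_k^*\rangle+\langle l^s\Phi_k,\Phi_k^*\rangle .$$ Then the system $$\frac{dl_+}{d\tau_{s,k}}=-[M_k^s,l_+]_+,\quad\frac{df_i}{d\tau_{s,k}}=(-M_k^s+\delta_k^il^s)f_i,\quad\frac{df_i^*}{d\tau_{s,k}}=(M_k^s-\delta_k^il^s)^*f_i^*,\quad\frac{d\Phi_i}{d\tau_{s,k}}=(-M_k^s+\delta_k^il^s)\Phi_i,\quad\frac{d\Phi_i^*}{d\tau_{s,k}}=(M_k^s-\delta_k^il^s)^*\Phi_i^*$$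 ($i=1,\dots,N$) is given by a vector field tangent to the phase space, and it is the Hamiltonian system of the functional $\lambda_k^s$ with respect to $\mathcal L$. More precisely, at every point $\lambda_k^s$ has the gradient $$\nabla\lambda_k^s=\bigl(M_k^s,\;(-M_k^s+\delta_k^il^s)^*f_i^*,\;(-M_k^s+\delta_k^il^s)\Phi_i,\;(-M_k^s+\delta_k^il^s)f_i,\;(-M_k^s+\delta_k^il^s)^*\Phi_i^*\bigr)^T,$$ and the system, written in the coordinates $(l,f_i,\Phi_i^*,f_i^*,\Phi_i)$, is $\frac{d}{d\tau_{s,k}}(l,f_i,\Phi_i^*,f_i^*,\Phi_i)^T=-\mathcal L\nabla\lambda_k^s$. -/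

import Mathlib

open scoped ContDiff

noncomputable section

namespace SuperLax

/-- A Banach commutative superalgebra `Λ = Λ₀ ⊕ Λ₁` over `ℂ` (for instance a Grassmann algebra).
The grading is given by the parity automorphism, which is `1` on `Λ₀` and `-1` on `Λ₁`. -/
class CommSuperalgebra (Λ : Type*) [NormedRing Λ] [NormedAlgebra ℂ Λ] where
  parity : Λ →A[ℂ] Λ
  parity_parity : ∀ a, parity (parity a) = a
  even_comm : ∀ a b, parity a = a → a * b = b * a
  odd_anticomm : ∀ a b, parity a = -a → parity b = -b → a * b = -(b * a)

section Functions

variable (Λ : Type*) [NormedRing Λ] [NormedAlgebra ℂ Λ]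

/-- Smooth `Λ`-valued functions on the circle `ℝ / 2πℤ`. -/
def CircleFn : Subalgebra ℂ (ℝ → Λ) where
  carrier := {u | ContDiff ℝ ∞ u ∧ Function.Periodic u (2 * Real.pi)}
  mul_mem' := fun ha hb => ⟨ha.1.mul hb.1, ha.2.mul hb.2⟩
  add_mem' := fun ha hb => ⟨ha.1.add hb.1, ha.2.add hb.2⟩
  algebraMap_mem' := fun _ => ⟨contDiff_const, fun _ => rfl⟩

/-- Smooth superfunctions `u(x, θ) = u⁰(x) + θ u¹(x)`, stored as pairs `(u⁰, u¹)`. -/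
def SuperFn : Type _ := CircleFn Λ × CircleFn Λ

instance : AddCommGroup (SuperFn Λ) := inferInstanceAs (AddCommGroup (CircleFn Λ × CircleFn Λ))

instance : Module ℂ (SuperFn Λ) := inferInstanceAs (Module ℂ (CircleFn Λ × CircleFn Λ))

end Functions

variable {Λ : Type*} [NormedRing Λ] [NormedAlgebra ℂ Λ]

/-- The derivative `∂ = d/dx` on the circle. -/
def circleDiff (u : CircleFn Λ) : CircleFn Λ :=
  ⟨deriv u.1, ((contDiff_infty_iff_deriv (𝕜 := ℝ)).1 u.2.1).2, fun x => by
    have h : (fun y => u.1 (y + 2 * Real.pi)) = u.1 := funext u.2.2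
    rw [← deriv_comp_add_const, h]⟩

/-- The mean value over the circle. -/
def circleMean (u : CircleFn Λ) : Λ :=
  (2 * Real.pi)⁻¹ • ∫ x in (0 : ℝ)..(2 * Real.pi), u.1 x

theorem circleContinuous (u : CircleFn Λ) : Continuous u.1 := u.2.1.continuous

/-- `x ↦ ∫₀ˣ (u - mean u)`. -/
def circlePrim [CompleteSpace Λ] (u : CircleFn Λ) : CircleFn Λ :=
  ⟨fun x => ∫ t in (0 : ℝ)..x, (u.1 t - circleMean u), by
    have hc : Continuous fun t => u.1 t - circleMean u := (circleContinuous u).sub continuous_const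
    have hd : ∀ x, HasDerivAt (fun x => ∫ t in (0 : ℝ)..x, (u.1 t - circleMean u))
        (u.1 x - circleMean u) x := fun x => hc.integral_hasStrictDerivAt 0 x |>.hasDerivAt
    constructor
    · refine (contDiff_infty_iff_deriv (𝕜 := ℝ)).2 ⟨fun x => (hd x).differentiableAt, ?_⟩
      rw [show deriv (fun x => ∫ t in (0 : ℝ)..x, (u.1 t - circleMean u)) = fun x => u.1 x - circleMean u from
        funext fun x => (hd x).deriv]
      exact u.2.1.sub contDiff_const
    · intro x
      have hp : Function.Periodic (fun t => u.1 t - circleMean u) (2 * Real.pi) := fun t => by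
        simp only [u.2.2 t]
      have hz : ∫ t in (0 : ℝ)..(2 * Real.pi), (u.1 t - circleMean u) = 0 := by
        rw [intervalIntegral.integral_sub ((circleContinuous u).intervalIntegrable _ _)
          (continuous_const.intervalIntegrable _ _), intervalIntegral.integral_const, sub_zero,
          circleMean, smul_smul, mul_inv_cancel₀ (by positivity), one_smul, sub_self]
      have h2 := hp.intervalIntegral_add_eq x 0
      rw [zero_add, hz] at h2
      change (∫ t in (0 : ℝ)..(x + 2 * Real.pi), (u.1 t - circleMean u)) = _
      rw [← intervalIntegral.integral_add_adjacent_intervals (hc.intervalIntegrable 0 x)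
        (hc.intervalIntegrable x (x + 2 * Real.pi)), h2, add_zero]⟩

/-- Constant functions. -/
def circleConst (c : Λ) : CircleFn Λ := ⟨fun _ => c, contDiff_const, fun _ => rfl⟩

/-- `∂⁻¹ u`: the antiderivative of `u - mean u` whose mean value is zero. On functions of mean value
zero it is a two-sided inverse of `∂`. -/
def circleInvDiff [CompleteSpace Λ] (u : CircleFn Λ) : CircleFn Λ :=
  circlePrim u - circleConst (circleMean (circlePrim u))

section Super

variable [CommSuperalgebra Λ]

/-- The parity automorphism applied to the values of a function. -/
def circleConj (u : CircleFn Λ) : CircleFn Λ :=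
  ⟨fun x => CommSuperalgebra.parity (u.1 x),
    ((CommSuperalgebra.parity (Λ := Λ)).toContinuousLinearMap.restrictScalars ℝ).contDiff.comp
      u.2.1,
    fun x => by simp only [u.2.2 x]⟩

namespace SuperFn

/-- `(u⁰ + θ u¹)(v⁰ + θ v¹)`, with `θ² = 0` and `a θ = θ · parity a` for `a ∈ Λ`. -/
instance : Mul (SuperFn Λ) := ⟨fun u v => (u.1 * v.1, u.2 * v.1 + circleConj u.1 * v.2)⟩

/-- The parity automorphism `u ↦ (-1)^{p(u)} u` of superfunctions. -/
def sigma (u : SuperFn Λ) : SuperFn Λ := (circleConj u.1, -circleConj u.2)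

/-- `twist n u = (-1)^{n p(u)} u`. -/
def twist (n : ℤ) (u : SuperFn Λ) : SuperFn Λ := if Even n then u else sigma u

/-- Even superfunctions. -/
def IsEven (u : SuperFn Λ) : Prop := sigma u = u

/-- Odd superfunctions. -/
def IsOdd (u : SuperFn Λ) : Prop := sigma u = -u


/-- The superderivative `D_θ = ∂/∂θ + θ ∂/∂x`. -/
def D (u : SuperFn Λ) : SuperFn Λ := (u.2, circleDiff u.1)

/-- The operator `D_θ⁻¹ = ∂⁻¹ D_θ` on superfunctions, `u⁰ + θ u¹ ↦ ∂⁻¹ u¹ + θ u⁰`. -/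
def Dinv [CompleteSpace Λ] (u : SuperFn Λ) : SuperFn Λ := (circleInvDiff u.2, u.1)

/-- The integral `∫₀^{2π} dx ∫ dθ u`, with the Berezin rule `∫ dθ (u⁰ + θ u¹) = u¹`. -/
def integral (u : SuperFn Λ) : Λ := ∫ x in (0 : ℝ)..(2 * Real.pi), u.2.1 x

/-- The pairing `⟨w, w⋆⟩ = ∫ dx dθ res (w D_θ⁻¹ w⋆) = (-1)^{p(w⋆)} ∫ dx dθ w w⋆` of eigenfunctions
with adjoint eigenfunctions. -/
def pairing (w ws : SuperFn Λ) : Λ := integral (w * sigma ws)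

end SuperFn

open SuperFn

/-! ### Formal operators `∑ a_j D_θ^j`, given by their coefficients -/

/-- The binomial coefficient `[i, k]` in
`D_θ^i ∘ u = ∑_{k ≥ 0} [i, k] (-1)^{p(u)(i-k)} (D_θ^k u) D_θ^{i-k}`, for all `i ∈ ℤ`. -/
def superBinom (i : ℤ) (k : ℕ) : ℤ :=
  if Even i ∧ Odd k then 0 else Ring.choose (i / 2) (k / 2)

/-- The product `a ∘ b` of formal operators (the sum is finite if the orders of both are bounded
from above): `D_θ^{i+j-k}` has the coefficients `a_i [i, k] (-1)^{p(b_j)(i-k)} (D_θ^k b_j)`. -/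
def comp (a b : ℤ → SuperFn Λ) : ℤ → SuperFn Λ := fun n =>
  ∑ᶠ p : ℤ × ℤ, if n ≤ p.1 + p.2 then
    superBinom p.1 (p.1 + p.2 - n).toNat •
      (a p.1 * D^[(p.1 + p.2 - n).toNat] (twist (n - p.2) (b p.2)))
  else 0

/-- The commutator `[a, b] = a ∘ b - b ∘ a`. -/
def comm (a b : ℤ → SuperFn Λ) : ℤ → SuperFn Λ := comp a b - comp b a

/-- The differential part `a₊`. -/
def plus (a : ℤ → SuperFn Λ) : ℤ → SuperFn Λ := fun n => if 0 ≤ n then a n else 0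

/-- The Lie algebra `𝒢` of even formal operators of finite order. -/
def IsOperator (a : ℤ → SuperFn Λ) : Prop :=
  (∃ m : ℤ, ∀ j, m < j → a j = 0) ∧ ∀ j, (Even j → IsEven (a j)) ∧ (Odd j → IsOdd (a j))

/-- Its subalgebra `𝒢₊` of differential operators. -/
def IsDiffOperator (a : ℤ → SuperFn Λ) : Prop := IsOperator a ∧ ∀ j < 0, a j = 0

/-- The scalar product `(a, b) = ∫ dx dθ res (a ∘ b)`, where `res a = a_{-1}`. -/
def opPairing (a b : ℤ → SuperFn Λ) : Λ := integral (comp a b (-1))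

/-- The formal operator `u D_θ⁻¹ v`, as the product of `u D_θ⁻¹` and `v`. -/
def ker (u v : SuperFn Λ) : ℤ → SuperFn Λ := comp (Pi.single (-1) u) (Pi.single 0 v)

/-! ### Action on superfunctions -/

/-- The action of the differential part `a₊ = ∑_{j ≥ 0} a_j D_θ^j`. -/
def diffAct (a : ℤ → SuperFn Λ) (h : SuperFn Λ) : SuperFn Λ := ∑ᶠ j : ℕ, a j * D^[j] h

/-- The action of the adjoint `(a₊)⋆ = ∑_{j ≥ 0} (-1)^{j(j-1)/2} D_θ^j ∘ a_j`. -/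
def diffAdj (a : ℤ → SuperFn Λ) (h : SuperFn Λ) : SuperFn Λ :=
  ∑ᶠ j : ℕ, (-1 : ℤ) ^ (j * (j - 1) / 2) • D^[j] (a j * h)

variable [CompleteSpace Λ]

/-- The action of `u D_θ⁻¹ v`. -/
def kerAct (u v h : SuperFn Λ) : SuperFn Λ := u * Dinv (v * h)

/-- The action of the adjoint `(u D_θ⁻¹ v)⋆ = - v D_θ⁻¹ u` (for `u D_θ⁻¹ v` even). -/
def kerAdj (u v h : SuperFn Λ) : SuperFn Λ := -(v * Dinv (u * h))

end Super

/-! ### The extended phase space -/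

/-- A tuple `(l, f_i, Φ⋆_i, f⋆_i, Φ_i)`, used for points `(l̃, f_i, …)` of the phase space, for
tangent vectors and for gradients. -/
@[ext]
structure Tuple (Λ : Type*) [NormedRing Λ] [NormedAlgebra ℂ Λ] (N : ℕ) where
  op : ℤ → SuperFn Λ
  f : Fin N → SuperFn Λ
  Φs : Fin N → SuperFn Λ
  fs : Fin N → SuperFn Λ
  Φ : Fin N → SuperFn Λ

variable {N : ℕ}

instance : Neg (Tuple Λ N) := ⟨fun V => ⟨-V.op, -V.f, -V.Φs, -V.fs, -V.Φ⟩⟩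

/-- The point `P + ε V`. -/
def move (P V : Tuple Λ N) (ε : ℂ) : Tuple Λ N :=
  ⟨P.op + ε • V.op, P.f + ε • V.f, P.Φs + ε • V.Φs, P.fs + ε • V.fs, P.Φ + ε • V.Φ⟩

variable [CommSuperalgebra Λ]

/-- The phase space of all `(l̃, f_i, Φ⋆_i, f⋆_i, Φ_i)` with `l̃ = l₊` an even differential operator,
`f_i`, `Φ⋆_i` even and `f⋆_i`, `Φ_i` odd; also its tangent space. -/
def IsPhase (P : Tuple Λ N) : Prop :=
  IsDiffOperator P.op ∧ ∀ i, (P.f i).IsEven ∧ (P.Φs i).IsEven ∧ (P.fs i).IsOdd ∧ (P.Φ i).IsOdd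

/-- The space of gradients: an operator in `𝒢` and superfunctions of the opposite parities. -/
def IsCovector (G : Tuple Λ N) : Prop :=
  IsOperator G.op ∧ ∀ i, (G.f i).IsOdd ∧ (G.Φs i).IsOdd ∧ (G.fs i).IsEven ∧ (G.Φ i).IsEven

/-- The Bäcklund transformation `(l̃, f_i, …) ↦ (l, f_i, …)`,
`l = l̃ + ∑ (f_i D_θ⁻¹ f⋆_i + Φ_i D_θ⁻¹ Φ⋆_i)`. -/
def backlund (P : Tuple Λ N) : Tuple Λ N :=
  { P with op := P.op + ∑ i, (ker (P.f i) (P.fs i) + ker (P.Φ i) (P.Φs i)) }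

/-- The derivative of the Bäcklund transformation at `P` in the direction `V`. -/
def backlundDeriv (P V : Tuple Λ N) : Tuple Λ N :=
  { V with op := V.op + ∑ i, (ker (V.f i) (P.fs i) + ker (P.f i) (V.fs i) +
      ker (V.Φ i) (P.Φs i) + ker (P.Φ i) (V.Φs i)) }

/-- `G` is a gradient of the functional `γ` at the point with coordinates `(l, f_i, …)` that
corresponds to `P`:
`δγ = (G_l, δl) + ∑ (⟨δf_i, G_{f_i}⟩ + ⟨G_{Φ⋆_i}, δΦ⋆_i⟩ + ⟨G_{f⋆_i}, δf⋆_i⟩ + ⟨δΦ_i, G_{Φ_i}⟩)`. -/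
def IsGradient (γ : Tuple Λ N → Λ) (P G : Tuple Λ N) : Prop :=
  IsCovector G ∧ ∀ V, IsPhase V →
    HasDerivAt (fun ε : ℂ => γ (move P V ε))
      (opPairing G.op (backlundDeriv P V).op +
        ∑ i, (SuperFn.pairing (V.f i) (G.f i) + SuperFn.pairing (G.Φs i) (V.Φs i) +
          SuperFn.pairing (G.fs i) (V.fs i) + SuperFn.pairing (V.Φ i) (G.Φ i))) 0

/-- The gradient with respect to `(l̃, f̃_i, …)` in terms of the gradient with respect to
`(l, f_i, …)` (chain rule for the Bäcklund transformation). -/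
def gradTilde (P G : Tuple Λ N) : Tuple Λ N where
  op := G.op
  f := fun i => G.f i + diffAdj G.op (P.fs i)
  Φs := fun i => G.Φs i + diffAct G.op (P.Φ i)
  fs := fun i => G.fs i + diffAct G.op (P.f i)
  Φ := fun i => G.Φ i + diffAdj G.op (P.Φs i)

/-- The tensor product of the Lie-Poisson structure and of the canonical odd Poisson structure, in
the coordinates `(l̃, f̃_i, …)`. -/
def poissonTilde (P G : Tuple Λ N) : Tuple Λ N where
  op := comm P.op (plus G.op) - plus (comm P.op G.op)
  f := -G.fs
  Φs := G.Φ
  fs := G.f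
  Φ := -G.Φs

/-- The Poisson structure in the coordinates `(l, f_i, …)`, that is the image of `poissonTilde` under
the Bäcklund transformation. -/
def poisson (P G : Tuple Λ N) : Tuple Λ N where
  op := comm P.op (plus G.op) - plus (comm P.op G.op) +
    ∑ i, (ker (P.f i) ((gradTilde P G).f i) - ker ((gradTilde P G).fs i) (P.fs i) +
      ker (P.Φ i) ((gradTilde P G).Φ i) - ker ((gradTilde P G).Φs i) (P.Φs i))
  f := fun i => -G.fs i - diffAct G.op (P.f i)
  Φs := fun i => G.Φ i + diffAdj G.op (P.Φs i)
  fs := fun i => G.f i + diffAdj G.op (P.fs i)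
  Φ := fun i => -G.Φs i - diffAct G.op (P.Φ i)

variable [CompleteSpace Λ]

/-- The action of `l = l₊ + ∑ (f_i D_θ⁻¹ f⋆_i + Φ_i D_θ⁻¹ Φ⋆_i)`. -/
def lax (P : Tuple Λ N) (h : SuperFn Λ) : SuperFn Λ :=
  diffAct P.op h + ∑ i, (kerAct (P.f i) (P.fs i) h + kerAct (P.Φ i) (P.Φs i) h)

/-- The action of the adjoint `l⋆`. -/
def laxAdj (P : Tuple Λ N) (h : SuperFn Λ) : SuperFn Λ :=
  diffAdj P.op h + ∑ i, (kerAdj (P.f i) (P.fs i) h + kerAdj (P.Φ i) (P.Φs i) h)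

/-- The functional `λ_k^s = ⟨l^s f_k, f⋆_k⟩ + ⟨l^s Φ_k, Φ⋆_k⟩`. -/
def eigenPower (k : Fin N) (s : ℕ) (P : Tuple Λ N) : Λ :=
  SuperFn.pairing ((lax P)^[s] (P.f k)) (P.fs k) +
    SuperFn.pairing ((lax P)^[s] (P.Φ k)) (P.Φs k)

/-- The formal operator
`M_k^s = ∑_{p < s} ((l^p f_k) D_θ⁻¹ (l⋆^{s-1-p} f⋆_k) + (l^p Φ_k) D_θ⁻¹ (l⋆^{s-1-p} Φ⋆_k))`. -/
def M (k : Fin N) (s : ℕ) (P : Tuple Λ N) : ℤ → SuperFn Λ :=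
  ∑ p ∈ Finset.range s,
    (ker ((lax P)^[p] (P.f k)) ((laxAdj P)^[s - 1 - p] (P.fs k)) +
      ker ((lax P)^[p] (P.Φ k)) ((laxAdj P)^[s - 1 - p] (P.Φs k)))

/-- The action of `M_k^s`. -/
def MAct (k : Fin N) (s : ℕ) (P : Tuple Λ N) (h : SuperFn Λ) : SuperFn Λ :=
  ∑ p ∈ Finset.range s,
    (kerAct ((lax P)^[p] (P.f k)) ((laxAdj P)^[s - 1 - p] (P.fs k)) h +
      kerAct ((lax P)^[p] (P.Φ k)) ((laxAdj P)^[s - 1 - p] (P.Φs k)) h)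

/-- The action of the adjoint of `M_k^s`. -/
def MAdj (k : Fin N) (s : ℕ) (P : Tuple Λ N) (h : SuperFn Λ) : SuperFn Λ :=
  ∑ p ∈ Finset.range s,
    (kerAdj ((lax P)^[p] (P.f k)) ((laxAdj P)^[s - 1 - p] (P.fs k)) h +
      kerAdj ((lax P)^[p] (P.Φ k)) ((laxAdj P)^[s - 1 - p] (P.Φs k)) h)

/-- The additional-symmetry vector field `d/dτ_{s,k}` in the coordinates `(l₊, f_i, …)`. -/
def ghostFlow (k : Fin N) (s : ℕ) (P : Tuple Λ N) : Tuple Λ N where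
  op := -plus (comm (M k s P) P.op)
  f := fun i => -MAct k s P (P.f i) + if i = k then (lax P)^[s] (P.f i) else 0
  Φs := fun i => MAdj k s P (P.Φs i) - if i = k then (laxAdj P)^[s] (P.Φs i) else 0
  fs := fun i => MAdj k s P (P.fs i) - if i = k then (laxAdj P)^[s] (P.fs i) else 0
  Φ := fun i => -MAct k s P (P.Φ i) + if i = k then (lax P)^[s] (P.Φ i) else 0

/-- The gradient of `λ_k^s` in terms of `M_k^s`. -/
def eigenGrad (k : Fin N) (s : ℕ) (P : Tuple Λ N) : Tuple Λ N where
  op := M k s P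
  f := fun i => -MAdj k s P (P.fs i) + if i = k then (laxAdj P)^[s] (P.fs i) else 0
  Φs := fun i => -MAct k s P (P.Φ i) + if i = k then (lax P)^[s] (P.Φ i) else 0
  fs := fun i => -MAct k s P (P.f i) + if i = k then (lax P)^[s] (P.f i) else 0
  Φ := fun i => -MAdj k s P (P.Φs i) + if i = k then (laxAdj P)^[s] (P.Φs i) else 0

end SuperLax

end

/-! The operator $M_k^s$ is a sum of kernels $uD_\theta^{-1}v$, hence of order at most $-1$, so its
differential part vanishes. In $\mathcal L\nabla\lambda_k^s$ every term containing
$(\delta\gamma/\delta l)_+$ therefore drops out, the gradients with and without tildes coincide, and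
once the gradient is known the Hamiltonian form is a comparison of signs
(`backlundDeriv_ghostFlow`). The substance is the gradient formula (`isGradient_eigenPower`).

By the product rule the variation of $\langle l^sf_k,f_k^*\rangle$ consists of two boundary terms,
which vary $f_k$ and $f_k^*$ and produce the summands with $\delta_k^i$, and of the terms
$\langle(\delta l)w,z\rangle$ with $w=l^pf_k$, $z=l^{*\,s-1-p}f_k^*$ (`exists_hasJet_lax_iterate`);
the part with $\Phi_k$ is analogous. Each such term is expressed through the kernel
$wD_\theta^{-1}z$, and the sum of these kernels is $M_k^s$. For $A=\delta l_+$ one has $\langle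
Aw,z\rangle=\langle w,A^*z\rangle=(wD_\theta^{-1}z,A)$ by `opPairing_ker`. For the variations of the
factors of $f_iD_\theta^{-1}f_i^*$ and $\Phi_iD_\theta^{-1}\Phi_i^*$, graded commutativity exchanges
the kernel being varied with $wD_\theta^{-1}z$ (`pairing_kerAct_exchange_left`,
`pairing_kerAct_exchange_right`), which gives the components with $-M_k^s$. Finally $(M_k^s,\delta
l)=(M_k^s,\delta l_+)$, because the product of two operators of negative order has order at most
$-2$ and so no residue.

Underneath lie integration by parts for $D_\theta$ and $D_\theta^{-1}$ on the circle, and the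
Leibniz rule for $D_\theta^j$ with its binomial identities. Since $l$ and the fields depend
polynomially on the parameter of a line in the phase space, variations are computed as first-order
jets of polynomial paths; no topology on superfunctions is needed, and a derivative is taken only
for the resulting path in $\Lambda$. -/

noncomputable section

namespace SuperLax

/-! ### Differentiation, integration and $\partial^{-1}$ on the circle. -/

section CircleFunctions

variable {Λ : Type*} [NormedRing Λ] [NormedAlgebra ℂ Λ]

theorem circleFn_ext {u v : CircleFn Λ} (h : ∀ x, u.1 x = v.1 x) : u = v :=
  Subtype.ext (funext h)

theorem circleFn_hasDerivAt (u : CircleFn Λ) (x : ℝ) : HasDerivAt u.1 ((circleDiff u).1 x) x :=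
  ((u.2.1.differentiable (by simp)) x).hasDerivAt

theorem circleDiff_eq {u v : CircleFn Λ} (h : ∀ x, HasDerivAt u.1 (v.1 x) x) : circleDiff u = v :=
  circleFn_ext fun x => (h x).deriv

theorem circleDiff_add (u v : CircleFn Λ) : circleDiff (u + v) = circleDiff u + circleDiff v :=
  circleDiff_eq fun x => (circleFn_hasDerivAt u x).add (circleFn_hasDerivAt v x)

theorem circleDiff_smul (c : ℂ) (u : CircleFn Λ) : circleDiff (c • u) = c • circleDiff u :=
  circleDiff_eq fun x => (circleFn_hasDerivAt u x).const_smul c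

theorem circleDiff_mul (u v : CircleFn Λ) :
    circleDiff (u * v) = circleDiff u * v + u * circleDiff v :=
  circleDiff_eq fun x => (circleFn_hasDerivAt u x).mul (circleFn_hasDerivAt v x)

theorem circleFn_neg_mul (u v : CircleFn Λ) : -u * v = -(u * v) :=
  circleFn_ext fun x => neg_mul (u.1 x) (v.1 x)

theorem circleFn_mul_neg (u v : CircleFn Λ) : u * -v = -(u * v) :=
  circleFn_ext fun x => mul_neg (u.1 x) (v.1 x)

/-- The integral over the circle. -/
def circleIntegral (u : CircleFn Λ) : Λ := ∫ x in (0 : ℝ)..(2 * Real.pi), u.1 x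

theorem circleFn_intervalIntegrable (u : CircleFn Λ) (a b : ℝ) :
    IntervalIntegrable u.1 MeasureTheory.volume a b :=
  (circleContinuous u).intervalIntegrable a b

theorem circleIntegral_add (u v : CircleFn Λ) :
    circleIntegral (u + v) = circleIntegral u + circleIntegral v :=
  intervalIntegral.integral_add (circleFn_intervalIntegrable u _ _)
    (circleFn_intervalIntegrable v _ _)

theorem circleIntegral_smul (c : ℂ) (u : CircleFn Λ) :
    circleIntegral (c • u) = c • circleIntegral u :=
  intervalIntegral.integral_smul c u.1

theorem circleMean_eq (u : CircleFn Λ) : circleMean u = (2 * Real.pi)⁻¹ • circleIntegral u := rfl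

theorem circleIntegral_eq_smul_mean (u : CircleFn Λ) :
    circleIntegral u = (2 * Real.pi) • circleMean u := by
  rw [circleMean_eq, smul_smul, mul_inv_cancel₀ (by positivity), one_smul]

variable [CompleteSpace Λ]

theorem circleIntegral_circleDiff (u : CircleFn Λ) : circleIntegral (circleDiff u) = 0 := by
  have h := intervalIntegral.integral_eq_sub_of_hasDerivAt (a := 0) (b := 2 * Real.pi)
    (fun x _ => circleFn_hasDerivAt u x) (circleFn_intervalIntegrable (circleDiff u) _ _)
  have hp := u.2.2 0
  rw [zero_add] at hp
  rw [circleIntegral, h, hp, sub_self]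

theorem circleIntegral_const (c : Λ) : circleIntegral (circleConst c) = (2 * Real.pi) • c := by
  simp [circleIntegral, circleConst]

theorem circleIntegral_const_mul (c : Λ) (u : CircleFn Λ) :
    circleIntegral (circleConst c * u) = c * circleIntegral u :=
  ((ContinuousLinearMap.mul ℝ Λ) c).intervalIntegral_comp_comm (circleFn_intervalIntegrable u _ _)

theorem circleIntegral_mul_const (u : CircleFn Λ) (c : Λ) :
    circleIntegral (u * circleConst c) = circleIntegral u * c :=
  ((ContinuousLinearMap.mul ℝ Λ).flip c).intervalIntegral_comp_comm
    (circleFn_intervalIntegrable u _ _)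

theorem circleDiff_circleInvDiff (u : CircleFn Λ) :
    circleDiff (circleInvDiff u) = u - circleConst (circleMean u) :=
  circleDiff_eq fun x => by
    have hc : Continuous fun t => u.1 t - circleMean u :=
      (circleContinuous u).sub continuous_const
    exact (hc.integral_hasStrictDerivAt 0 x).hasDerivAt.sub_const _

theorem circleIntegral_circleInvDiff (u : CircleFn Λ) : circleIntegral (circleInvDiff u) = 0 := by
  have h := circleIntegral_add (circleInvDiff u) (circleConst (circleMean (circlePrim u)))
  rw [circleIntegral_const, ← circleIntegral_eq_smul_mean,
    show circleInvDiff u + circleConst (circleMean (circlePrim u)) = circlePrim u from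
      sub_add_cancel _ _] at h
  exact (left_eq_add.mp (h.trans (add_comm _ _)))

/-- Functions of mean value zero with the same derivative coincide. -/
theorem circleFn_eq_of_diff {u v : CircleFn Λ} (hd : circleDiff u = circleDiff v)
    (hi : circleIntegral u = circleIntegral v) : u = v := by
  have hder : ∀ x, HasDerivAt (fun y => u.1 y - v.1 y) 0 x := fun x => by
    have h := (circleFn_hasDerivAt u x).sub (circleFn_hasDerivAt v x)
    rw [hd, sub_self] at h
    exact h
  have hconst : ∀ x, u.1 x - v.1 x = u.1 0 - v.1 0 := fun x =>
    is_const_of_deriv_eq_zero (fun y => (hder y).differentiableAt) (fun y => (hder y).deriv) x 0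
  have huv : u = v + circleConst (u.1 0 - v.1 0) := circleFn_ext fun x => by
    change u.1 x = v.1 x + (u.1 0 - v.1 0)
    rw [← hconst x]
    abel
  have h2 := circleIntegral_add v (circleConst (u.1 0 - v.1 0))
  rw [← huv, hi, circleIntegral_const, left_eq_add] at h2
  have h3 : u.1 0 - v.1 0 = 0 := (smul_eq_zero.1 h2).resolve_left (by positivity)
  rw [huv, h3]
  exact circleFn_ext fun x => add_zero _

/-- The derivative together with the integral determines a function, so every algebraic property of
$\partial^{-1}$ below is checked on these two data. -/
theorem circleInvDiff_eq {u v : CircleFn Λ} (hd : circleDiff v = u - circleConst (circleMean u))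
    (hi : circleIntegral v = 0) : circleInvDiff u = v :=
  circleFn_eq_of_diff ((circleDiff_circleInvDiff u).trans hd.symm)
    ((circleIntegral_circleInvDiff u).trans hi.symm)

theorem circleInvDiff_add (u v : CircleFn Λ) :
    circleInvDiff (u + v) = circleInvDiff u + circleInvDiff v := by
  refine circleInvDiff_eq ?_ ?_
  · rw [circleDiff_add, circleDiff_circleInvDiff, circleDiff_circleInvDiff, circleMean_eq (u + v),
      circleIntegral_add, smul_add, ← circleMean_eq, ← circleMean_eq]
    refine circleFn_ext fun x => ?_
    change u.1 x - circleMean u + (v.1 x - circleMean v) =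
      u.1 x + v.1 x - (circleMean u + circleMean v)
    abel
  · rw [circleIntegral_add, circleIntegral_circleInvDiff, circleIntegral_circleInvDiff, add_zero]

theorem circleInvDiff_smul (c : ℂ) (u : CircleFn Λ) :
    circleInvDiff (c • u) = c • circleInvDiff u := by
  refine circleInvDiff_eq ?_ ?_
  · rw [circleDiff_smul, circleDiff_circleInvDiff, circleMean_eq (c • u), circleIntegral_smul,
      smul_comm, ← circleMean_eq, smul_sub]
    rfl
  · rw [circleIntegral_smul, circleIntegral_circleInvDiff, smul_zero]

/-- `∂⁻¹` is skew-symmetric. -/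
theorem circleIntegral_circleInvDiff_mul (u v : CircleFn Λ) :
    circleIntegral (circleInvDiff u * v) = -circleIntegral (u * circleInvDiff v) := by
  -- Integration by parts for $\partial^{-1}u\cdot\partial^{-1}v$. The corrections by the mean
  -- values of `u` and `v` integrate to zero because $\partial^{-1}$ takes values of mean zero.
  have h := circleIntegral_circleDiff (circleInvDiff u * circleInvDiff v)
  rw [circleDiff_mul, circleDiff_circleInvDiff, circleDiff_circleInvDiff] at h
  have h1 := circleIntegral_add ((u - circleConst (circleMean u)) * circleInvDiff v)
    (circleConst (circleMean u) * circleInvDiff v)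
  have h2 := circleIntegral_add (circleInvDiff u * (v - circleConst (circleMean v)))
    (circleInvDiff u * circleConst (circleMean v))
  rw [circleIntegral_const_mul, circleIntegral_circleInvDiff, mul_zero, add_zero, ← add_mul,
    sub_add_cancel] at h1
  rw [circleIntegral_mul_const, circleIntegral_circleInvDiff, zero_mul, add_zero, ← mul_add,
    sub_add_cancel] at h2
  rw [circleIntegral_add, ← h1, ← h2] at h
  exact eq_neg_of_add_eq_zero_right h

end CircleFunctions

/-! ### The parity automorphism on $\Lambda$ and on circle functions. -/

section Parity

variable {Λ : Type*} [NormedRing Λ] [NormedAlgebra ℂ Λ] [CommSuperalgebra Λ]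

/-- Twice `b` is the sum of the even element `b + parity b`, which commutes with `a`, and of the odd
element `b - parity b`, which anticommutes with it. -/
theorem odd_mul_eq {a : Λ} (ha : CommSuperalgebra.parity a = -a) (b : Λ) :
    a * b = CommSuperalgebra.parity b * a := by
  have hb0 : CommSuperalgebra.parity (b + CommSuperalgebra.parity b) =
      b + CommSuperalgebra.parity b := by
    rw [map_add, CommSuperalgebra.parity_parity, add_comm]
  have hb1 : CommSuperalgebra.parity (b - CommSuperalgebra.parity b) =
      -(b - CommSuperalgebra.parity b) := by
    rw [map_sub, CommSuperalgebra.parity_parity, neg_sub]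
  have h0 := CommSuperalgebra.even_comm _ a hb0
  have h1 := CommSuperalgebra.odd_anticomm _ _ ha hb1
  rw [add_mul, mul_add] at h0
  rw [sub_mul, mul_sub] at h1
  have h2 : (2 : ℂ) • (a * b) = (2 : ℂ) • (CommSuperalgebra.parity b * a) := by
    rw [two_smul, two_smul]
    have : a * b + a * b = (a * b + a * CommSuperalgebra.parity b) +
      (a * b - a * CommSuperalgebra.parity b) := by abel
    rw [this, ← h0, h1]
    abel
  exact smul_right_injective _ (two_ne_zero' ℂ) h2

theorem circleConj_add (u v : CircleFn Λ) : circleConj (u + v) = circleConj u + circleConj v :=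
  circleFn_ext fun _ => map_add CommSuperalgebra.parity _ _

theorem circleConj_neg (u : CircleFn Λ) : circleConj (-u) = -circleConj u :=
  circleFn_ext fun _ => map_neg CommSuperalgebra.parity _

theorem circleConj_zero : circleConj (0 : CircleFn Λ) = 0 :=
  circleFn_ext fun _ => map_zero CommSuperalgebra.parity

theorem circleConj_one : circleConj (1 : CircleFn Λ) = 1 :=
  circleFn_ext fun _ => map_one CommSuperalgebra.parity

theorem circleConj_mul (u v : CircleFn Λ) : circleConj (u * v) = circleConj u * circleConj v :=
  circleFn_ext fun _ => map_mul CommSuperalgebra.parity _ _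

theorem circleConj_smul (c : ℂ) (u : CircleFn Λ) : circleConj (c • u) = c • circleConj u :=
  circleFn_ext fun _ => map_smul CommSuperalgebra.parity _ _

theorem circleConj_circleConj (u : CircleFn Λ) : circleConj (circleConj u) = u :=
  circleFn_ext fun _ => CommSuperalgebra.parity_parity _

theorem circleDiff_circleConj (u : CircleFn Λ) :
    circleDiff (circleConj u) = circleConj (circleDiff u) :=
  circleDiff_eq fun x =>
    ((CommSuperalgebra.parity (Λ := Λ)).toContinuousLinearMap.restrictScalars
      ℝ).hasFDerivAt.comp_hasDerivAt x (circleFn_hasDerivAt u x)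

theorem circleIntegral_circleConj [CompleteSpace Λ] (u : CircleFn Λ) :
    circleIntegral (circleConj u) = CommSuperalgebra.parity (circleIntegral u) :=
  ((CommSuperalgebra.parity (Λ := Λ)).toContinuousLinearMap).intervalIntegral_comp_comm
    (circleFn_intervalIntegrable u _ _)

theorem circleInvDiff_circleConj [CompleteSpace Λ] (u : CircleFn Λ) :
    circleInvDiff (circleConj u) = circleConj (circleInvDiff u) := by
  refine circleInvDiff_eq ?_ ?_
  · rw [circleDiff_circleConj, circleDiff_circleInvDiff, sub_eq_add_neg, circleConj_add,
      circleConj_neg, ← sub_eq_add_neg, circleMean_eq (circleConj u), circleIntegral_circleConj]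
    congr 1
    refine circleFn_ext fun x => ?_
    change CommSuperalgebra.parity (circleMean u) = _
    rw [circleMean_eq]
    exact ((CommSuperalgebra.parity (Λ := Λ)).toContinuousLinearMap.restrictScalars ℝ).map_smul _ _
  · rw [circleIntegral_circleConj, circleIntegral_circleInvDiff, map_zero]

end Parity

/-! ### The ring of superfunctions, with $D_\theta$, $D_\theta^{-1}$ and the Berezin integral. -/

namespace SuperFn

variable {Λ : Type*} [NormedRing Λ] [NormedAlgebra ℂ Λ]

@[ext]
theorem ext {u v : SuperFn Λ} (h1 : u.1 = v.1) (h2 : u.2 = v.2) : u = v := Prod.ext h1 h2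

@[simp] theorem add_fst (u v : SuperFn Λ) : (u + v).1 = u.1 + v.1 := rfl
@[simp] theorem add_snd (u v : SuperFn Λ) : (u + v).2 = u.2 + v.2 := rfl
@[simp] theorem neg_fst (u : SuperFn Λ) : (-u).1 = -u.1 := rfl
@[simp] theorem neg_snd (u : SuperFn Λ) : (-u).2 = -u.2 := rfl
@[simp] theorem zero_fst : (0 : SuperFn Λ).1 = 0 := rfl
@[simp] theorem zero_snd : (0 : SuperFn Λ).2 = 0 := rfl
@[simp] theorem smul_fst (c : ℂ) (u : SuperFn Λ) : (c • u).1 = c • u.1 := rfl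
@[simp] theorem smul_snd (c : ℂ) (u : SuperFn Λ) : (c • u).2 = c • u.2 := rfl

@[simp] theorem D_fst (u : SuperFn Λ) : (D u).1 = u.2 := rfl
@[simp] theorem D_snd (u : SuperFn Λ) : (D u).2 = circleDiff u.1 := rfl

theorem integral_D [CompleteSpace Λ] (u : SuperFn Λ) : integral (D u) = 0 := circleIntegral_circleDiff u.1

variable [CommSuperalgebra Λ]

@[simp] theorem mul_fst (u v : SuperFn Λ) : (u * v).1 = u.1 * v.1 := rfl
@[simp] theorem mul_snd (u v : SuperFn Λ) : (u * v).2 = u.2 * v.1 + circleConj u.1 * v.2 := rfl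
@[simp] theorem sigma_fst (u : SuperFn Λ) : (sigma u).1 = circleConj u.1 := rfl
@[simp] theorem sigma_snd (u : SuperFn Λ) : (sigma u).2 = -circleConj u.2 := rfl

instance : Ring (SuperFn Λ) :=
  { (inferInstance : AddCommGroup (SuperFn Λ)), (inferInstance : Mul (SuperFn Λ)) with
    one := ((1 : CircleFn Λ), (0 : CircleFn Λ))
    mul_assoc := fun u v w => by
      ext1
      · exact mul_assoc _ _ _
      · simp only [mul_snd, mul_fst, circleConj_mul]
        noncomm_ring
    one_mul := fun u => by
      ext1
      · exact one_mul u.1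
      · change (0 : CircleFn Λ) * u.1 + circleConj 1 * u.2 = u.2
        rw [circleConj_one, zero_mul, one_mul, zero_add]
    mul_one := fun u => by
      ext1
      · exact mul_one u.1
      · change u.2 * (1 : CircleFn Λ) + circleConj u.1 * 0 = u.2
        rw [mul_one, mul_zero, add_zero]
    left_distrib := fun u v w => by
      ext1
      · exact mul_add _ _ _
      · simp only [mul_snd, add_fst, add_snd]
        noncomm_ring
    right_distrib := fun u v w => by
      ext1
      · exact add_mul _ _ _
      · simp only [mul_snd, add_fst, add_snd, circleConj_add]
        noncomm_ring
    zero_mul := fun u => by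
      ext1
      · exact zero_mul _
      · simp [circleConj_zero]
    mul_zero := fun u => by
      ext1
      · exact mul_zero _
      · simp }

instance : IsScalarTower ℂ (SuperFn Λ) (SuperFn Λ) :=
  ⟨fun c u v => by
    ext1
    · exact smul_mul_assoc c u.1 v.1
    · simp [circleConj_smul]⟩

instance : SMulCommClass ℂ (SuperFn Λ) (SuperFn Λ) :=
  ⟨fun c u v => by
    ext1
    · exact (mul_smul_comm c u.1 v.1).symm
    · simp⟩

/-- The parity automorphism as a linear map. -/
def sigmaLin : SuperFn Λ →ₗ[ℂ] SuperFn Λ where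
  toFun := sigma
  map_add' u v := by
    ext1
    · exact circleConj_add _ _
    · simp [circleConj_add, add_comm]
  map_smul' c u := by
    ext1
    · exact circleConj_smul _ _
    · simp [circleConj_smul]

/-- The superderivative as a linear map. -/
def DLin : SuperFn Λ →ₗ[ℂ] SuperFn Λ where
  toFun := D
  map_add' u v := by
    ext1
    · rfl
    · exact circleDiff_add _ _
  map_smul' c u := by
    ext1
    · rfl
    · exact circleDiff_smul _ _

theorem sigma_add (u v : SuperFn Λ) : sigma (u + v) = sigma u + sigma v := map_add sigmaLin u v
theorem sigma_neg (u : SuperFn Λ) : sigma (-u) = -sigma u := map_neg sigmaLin u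
theorem sigma_zero : sigma (0 : SuperFn Λ) = 0 := map_zero sigmaLin
theorem sigma_smul (c : ℂ) (u : SuperFn Λ) : sigma (c • u) = c • sigma u := map_smul sigmaLin c u

theorem D_neg (u : SuperFn Λ) : D (-u) = -D u := map_neg DLin u

theorem sigma_sigma (u : SuperFn Λ) : sigma (sigma u) = u := by
  ext1
  · exact circleConj_circleConj _
  · simp [circleConj_neg, circleConj_circleConj]

theorem sigma_mul (u v : SuperFn Λ) : sigma (u * v) = sigma u * sigma v := by
  ext1
  · exact circleConj_mul _ _
  · have h : ∀ a b c d : CircleFn Λ, -(a * b + c * d) = -a * b + c * -d := fun a b c d => by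
      rw [circleFn_neg_mul, circleFn_mul_neg, neg_add]
    simp only [sigma_fst, sigma_snd, mul_snd, circleConj_add, circleConj_mul]
    exact h _ _ _ _

theorem D_sigma (u : SuperFn Λ) : D (sigma u) = -sigma (D u) := by
  ext1
  · rfl
  · simp [circleDiff_circleConj]

theorem sigma_D (u : SuperFn Λ) : sigma (D u) = -D (sigma u) := by rw [D_sigma, neg_neg]

/-- The graded Leibniz rule. -/
theorem D_mul (u v : SuperFn Λ) : D (u * v) = D u * v + sigma u * D v := by
  ext1
  · simp
  · simp only [D_snd, D_fst, mul_fst, mul_snd, add_snd, sigma_fst, sigma_snd, circleDiff_mul,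
      circleConj_circleConj]
    have h : ∀ a b c d : CircleFn Λ, a + b = a + c * d + (-c * d + b) := fun a b c d => by
      rw [circleFn_neg_mul]
      abel
    exact h _ _ _ _

/-- Since $\theta$ is odd, the $\theta$-component of an even superfunction has odd values, and
moving it past `v.1` costs one parity automorphism: exactly the one built into the product. In the
odd case the roles of the components are interchanged and a `sigma` remains. The other factor need
not be homogeneous. -/
theorem IsEven.mul_comm {u : SuperFn Λ} (hu : u.IsEven) (v : SuperFn Λ) : u * v = v * u := by
  have h0 : circleConj u.1 = u.1 := congrArg Prod.fst hu
  have h1 : circleConj u.2 = -u.2 := neg_eq_iff_eq_neg.1 (congrArg Prod.snd hu)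
  have e0 : ∀ w : CircleFn Λ, u.1 * w = w * u.1 := fun w => circleFn_ext fun x =>
    CommSuperalgebra.even_comm _ _ (congrFun (congrArg Subtype.val h0) x)
  have e1 : ∀ w : CircleFn Λ, u.2 * w = circleConj w * u.2 := fun w => circleFn_ext fun x =>
    odd_mul_eq (congrFun (congrArg Subtype.val h1) x) _
  ext1
  · exact e0 _
  · rw [mul_snd, mul_snd, h0, e0, e1, add_comm]

theorem IsOdd.mul_comm {u : SuperFn Λ} (hu : u.IsOdd) (v : SuperFn Λ) : u * v = sigma v * u := by
  have h0 : circleConj u.1 = -u.1 := congrArg Prod.fst hu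
  have h1 : circleConj u.2 = u.2 := neg_injective (congrArg Prod.snd hu)
  have e0 : ∀ w : CircleFn Λ, u.1 * w = circleConj w * u.1 := fun w => circleFn_ext fun x =>
    odd_mul_eq (congrFun (congrArg Subtype.val h0) x) _
  have e1 : ∀ w : CircleFn Λ, u.2 * w = w * u.2 := fun w => circleFn_ext fun x =>
    CommSuperalgebra.even_comm _ _ (congrFun (congrArg Subtype.val h1) x)
  ext1
  · exact e0 _
  · have h : ∀ a b : CircleFn Λ, a + -u.1 * b = -circleConj b * u.1 + a := fun a b => by
      rw [circleFn_neg_mul, e0, circleFn_neg_mul, add_comm]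
    rw [mul_snd, mul_snd, h0, e1, sigma_snd, sigma_fst, circleConj_circleConj]
    exact h _ _

/-- The integral as a linear map. -/
def integralLin : SuperFn Λ →ₗ[ℂ] Λ where
  toFun := integral
  map_add' u v := circleIntegral_add u.2 v.2
  map_smul' c u := circleIntegral_smul c u.2

theorem integral_add (u v : SuperFn Λ) : integral (u + v) = integral u + integral v :=
  map_add integralLin u v
theorem integral_neg (u : SuperFn Λ) : integral (-u) = -integral u := map_neg integralLin u

variable [CompleteSpace Λ]

/-- `D_θ⁻¹` as a linear map. -/
def DinvLin : SuperFn Λ →ₗ[ℂ] SuperFn Λ where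
  toFun := Dinv
  map_add' u v := by
    ext1
    · exact circleInvDiff_add _ _
    · rfl
  map_smul' c u := by
    ext1
    · exact circleInvDiff_smul _ _
    · rfl

theorem Dinv_neg (u : SuperFn Λ) : Dinv (-u) = -Dinv u := map_neg DinvLin u
theorem Dinv_sigma (u : SuperFn Λ) : Dinv (sigma u) = -sigma (Dinv u) := by
  ext1
  · change circleInvDiff (-circleConj u.2) = -circleConj (circleInvDiff u.2)
    rw [← circleInvDiff_circleConj]
    exact congrArg Prod.fst (Dinv_neg ((0 : CircleFn Λ), circleConj u.2))
  · exact (neg_neg _).symm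

theorem integral_D_mul (u v : SuperFn Λ) : integral (D u * v) = -integral (sigma u * D v) := by
  have h := integral_D (u * v)
  rw [D_mul, integral_add] at h
  exact eq_neg_of_add_eq_zero_left h

/-- In components, $u^0v^0$ occurs on both sides, and the products with $u^1$ and $v^1$ agree by
skew-symmetry of $\partial^{-1}$, whose sign is absorbed by `sigma`. Hence there is no minus sign,
in contrast to `integral_D_mul`. -/
theorem integral_Dinv_mul (u v : SuperFn Λ) :
    integral (Dinv u * v) = integral (sigma u * Dinv v) := by
  change circleIntegral (u.1 * v.1 + circleConj (circleInvDiff u.2) * v.2) =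
    circleIntegral (-circleConj u.2 * circleInvDiff v.2 + circleConj (circleConj u.1) * v.1)
  rw [circleConj_circleConj, ← circleInvDiff_circleConj, circleIntegral_add, circleIntegral_add,
    circleIntegral_circleInvDiff_mul, add_comm]
  congr 1
  have h : ∀ a b : CircleFn Λ, -circleIntegral (a * b) = circleIntegral (-a * b) := fun a b => by
    rw [circleFn_neg_mul, ← neg_one_smul ℂ (a * b), circleIntegral_smul, neg_one_smul]
  exact h _ _

end SuperFn

/-! ### Identities for the binomial coefficients of $D_\theta$. -/

section

theorem superBinom_natCast (j k : ℕ) :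
    superBinom j k = if Even j ∧ Odd k then 0 else ((j / 2).choose (k / 2) : ℤ) := by
  have h : (j : ℤ) / 2 = (j / 2 : ℕ) := by omega
  simp only [superBinom, Int.even_coe_nat, h, Ring.choose_natCast]

/-- Upper negation of the binomial coefficient, after rounding down:
$\lfloor(-1-k)/2\rfloor=-(\lfloor k/2\rfloor+1)$. -/
theorem superBinom_neg (k r : ℕ) :
    superBinom (-1 - k) r =
      if Odd k ∧ Odd r then 0 else (-1) ^ (r / 2) * ((k / 2 + r / 2).choose (r / 2) : ℤ) := by
  have h1 : Even (-1 - (k : ℤ)) ↔ Odd k := by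
    rw [Int.even_iff, Nat.odd_iff]
    omega
  have h2 : (-1 - (k : ℤ)) / 2 = -((k / 2 : ℕ) + 1 : ℤ) := by omega
  simp only [superBinom, h1, h2]
  rw [Ring.choose_neg,
    show ((k / 2 : ℕ) + 1 : ℤ) + (r / 2 : ℕ) - 1 = ((k / 2 + r / 2 : ℕ) : ℤ) by push_cast; ring,
    Ring.choose_natCast]
  congr 1

theorem superBinom_neg_one (k : ℕ) : superBinom (-1) k = (-1) ^ (k / 2) := by
  have h := superBinom_neg 0 k
  simpa using h

theorem superBinom_zero_right (i : ℤ) : superBinom i 0 = 1 := by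
  simp [superBinom]

theorem superBinom_self_succ (j : ℕ) : superBinom j (j + 1) = 0 := by
  rw [superBinom_natCast]
  split_ifs with h
  · rfl
  · have hj : j / 2 < (j + 1) / 2 := by
      rcases Nat.even_or_odd' j with ⟨m, rfl | rfl⟩
      · exact absurd ⟨even_two_mul m, odd_two_mul_add_one m⟩ h
      · omega
    rw [Nat.choose_eq_zero_of_lt hj, Nat.cast_zero]

/-- Pascal's rule. -/
theorem superBinom_succ_succ (j k : ℕ) :
    superBinom (j + 1 : ℕ) (k + 1) = superBinom j k + (-1) ^ (k + 1) * superBinom j (k + 1) := by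
  simp only [superBinom_natCast]
  -- Only for `j` and `k` both odd is this the classical Pascal rule for the halves. In the other
  -- cases one summand on the right is zero, or the two cancel.
  rcases Nat.even_or_odd' j with ⟨m, rfl | rfl⟩ <;> rcases Nat.even_or_odd' k with ⟨l, rfl | rfl⟩
  · have h1 : (2 * m + 1) / 2 = m := by omega
    have h2 : (2 * l + 1) / 2 = l := by omega
    simp [h1, h2, parity_simps]
  · have h1 : (2 * m + 1) / 2 = m := by omega
    have h2 : (2 * l + 1 + 1) / 2 = l + 1 := by omega
    simp [h1, h2, parity_simps]
  · have h1 : (2 * m + 1) / 2 = m := by omega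
    have h2 : (2 * l + 1) / 2 = l := by omega
    simp [h1, h2, parity_simps, pow_add, pow_mul]
  · have h1 : (2 * m + 1) / 2 = m := by omega
    have h2 : (2 * l + 1 + 1) / 2 = l + 1 := by omega
    have h3 : (2 * m + 1 + 1) / 2 = m + 1 := by omega
    have h4 : (2 * l + 1) / 2 = l := by omega
    simp [h1, h2, h3, h4, parity_simps, pow_add, pow_mul, Nat.choose_succ_succ]

/-- The associativity of `D_θ⁻¹ ∘ z ∘ A` at the level of the coefficients. -/
theorem superBinom_mul_superBinom {j k : ℕ} (h : k ≤ j) :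
    superBinom (-1) k * superBinom (-1 - k) (j - k) = superBinom (-1) j * superBinom j k := by
  obtain ⟨r, rfl⟩ := Nat.exists_eq_add_of_le h
  rw [Nat.add_sub_cancel_left, superBinom_neg_one, superBinom_neg_one, superBinom_neg,
    superBinom_natCast]
  -- Both sides vanish under the same condition. Outside of it the halves of `k` and `r` add up
  -- without a carry, and the symmetry of the ordinary binomial coefficient remains.
  have h0 : (Even (k + r) ∧ Odd k) ↔ (Odd k ∧ Odd r) := by
    simp only [Nat.even_iff, Nat.odd_iff]
    omega
  simp only [h0]
  split_ifs with h1
  · simp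
  · have h2 : (k + r) / 2 = k / 2 + r / 2 := by
      simp only [Nat.odd_iff] at h1
      omega
    rw [h2, pow_add, ← Nat.choose_symm_add]
    ring

/-! ### Homogeneous superfunctions, sign twists and the higher Leibniz rule. -/

namespace SuperFn

variable {Λ : Type*} [NormedRing Λ] [NormedAlgebra ℂ Λ] [CommSuperalgebra Λ]

/-- `u` is homogeneous of parity `n` mod `2`. -/
def HasParity (n : ℤ) (u : SuperFn Λ) : Prop := (Even n → IsEven u) ∧ (Odd n → IsOdd u)

theorem IsEven.neg {u : SuperFn Λ} (h : u.IsEven) : (-u).IsEven := by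
  rw [IsEven, sigma_neg, h]
theorem IsOdd.neg {u : SuperFn Λ} (h : u.IsOdd) : (-u).IsOdd := by
  rw [IsOdd, sigma_neg, h]
theorem IsEven.add {u v : SuperFn Λ} (h : u.IsEven) (h' : v.IsEven) : (u + v).IsEven := by
  rw [IsEven, sigma_add, h, h']
theorem IsOdd.add {u v : SuperFn Λ} (h : u.IsOdd) (h' : v.IsOdd) : (u + v).IsOdd := by
  rw [IsOdd, sigma_add, h, h', neg_add]
theorem IsEven.zero : (0 : SuperFn Λ).IsEven := sigma_zero
theorem IsOdd.zero : (0 : SuperFn Λ).IsOdd := by rw [IsOdd, sigma_zero, neg_zero]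
theorem IsEven.D {u : SuperFn Λ} (h : u.IsEven) : (D u).IsOdd := by
  rw [IsOdd, sigma_D, h]
theorem IsOdd.D {u : SuperFn Λ} (h : u.IsOdd) : (D u).IsEven := by
  rw [IsEven, sigma_D, h, D_neg, neg_neg]

theorem hasParity_zero_iff {u : SuperFn Λ} : HasParity 0 u ↔ u.IsEven := by
  simp [HasParity]

theorem hasParity_one_iff {u : SuperFn Λ} : HasParity 1 u ↔ u.IsOdd := by
  simp [HasParity]

theorem IsEven.hasParity {u : SuperFn Λ} (h : u.IsEven) : HasParity 0 u := hasParity_zero_iff.2 h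
theorem IsOdd.hasParity {u : SuperFn Λ} (h : u.IsOdd) : HasParity 1 u := hasParity_one_iff.2 h

theorem HasParity.congr {n m : ℤ} {u : SuperFn Λ} (h : HasParity n u) (hnm : Even (n - m)) :
    HasParity m u := by
  rw [Int.even_sub] at hnm
  exact ⟨fun hm => h.1 (hnm.2 hm), fun hm => h.2 (by rwa [← Int.not_even_iff_odd, hnm,
    Int.not_even_iff_odd])⟩

theorem HasParity.zero (n : ℤ) : HasParity n (0 : SuperFn Λ) :=
  ⟨fun _ => IsEven.zero, fun _ => IsOdd.zero⟩

theorem HasParity.neg {n : ℤ} {u : SuperFn Λ} (h : HasParity n u) : HasParity n (-u) :=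
  ⟨fun hn => (h.1 hn).neg, fun hn => (h.2 hn).neg⟩

theorem HasParity.add {n : ℤ} {u v : SuperFn Λ} (h : HasParity n u) (h' : HasParity n v) :
    HasParity n (u + v) :=
  ⟨fun hn => (h.1 hn).add (h'.1 hn), fun hn => (h.2 hn).add (h'.2 hn)⟩

theorem HasParity.zsmul {n : ℤ} {u : SuperFn Λ} (h : HasParity n u) (c : ℤ) :
    HasParity n (c • u) := by
  have hs : sigma (c • u) = c • sigma u := map_zsmul sigmaLin c u
  refine ⟨fun hn => ?_, fun hn => ?_⟩
  · rw [IsEven, hs, h.1 hn]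
  · rw [IsOdd, hs, h.2 hn, smul_neg]

theorem HasParity.sum {ι : Type*} {n : ℤ} {s : Finset ι} {u : ι → SuperFn Λ}
    (h : ∀ i ∈ s, HasParity n (u i)) : HasParity n (∑ i ∈ s, u i) :=
  Finset.sum_induction u (HasParity n) (fun _ _ => HasParity.add) (HasParity.zero n) h

theorem HasParity.finsum {ι : Sort*} {n : ℤ} {u : ι → SuperFn Λ}
    (h : ∀ i, HasParity n (u i)) : HasParity n (∑ᶠ i, u i) :=
  finsum_induction (HasParity n) (HasParity.zero n) (fun _ _ => HasParity.add) h

theorem HasParity.mul {n m : ℤ} {u v : SuperFn Λ} (h : HasParity n u) (h' : HasParity m v) :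
    HasParity (n + m) (u * v) := by
  rcases Int.even_or_odd n with hn | hn <;> rcases Int.even_or_odd m with hm | hm
  · refine ⟨fun _ => ?_, fun ho => ?_⟩
    · rw [IsEven, sigma_mul, h.1 hn, h'.1 hm]
    · exact absurd (hn.add hm) (Int.not_even_iff_odd.2 ho)
  · refine ⟨fun he => ?_, fun _ => ?_⟩
    · exact absurd he (Int.not_even_iff_odd.2 (hn.add_odd hm))
    · rw [IsOdd, sigma_mul, h.1 hn, h'.2 hm, mul_neg]
  · refine ⟨fun he => ?_, fun _ => ?_⟩
    · exact absurd he (Int.not_even_iff_odd.2 (hn.add_even hm))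
    · rw [IsOdd, sigma_mul, h.2 hn, h'.1 hm, neg_mul]
  · refine ⟨fun _ => ?_, fun ho => ?_⟩
    · rw [IsEven, sigma_mul, h.2 hn, h'.2 hm, neg_mul_neg]
    · exact absurd (hn.add_odd hm) (Int.not_even_iff_odd.2 ho)

theorem HasParity.D {n : ℤ} {u : SuperFn Λ} (h : HasParity n u) : HasParity (n + 1) (D u) :=
  ⟨fun hn => (h.2 (by rw [Int.odd_iff]; rw [Int.even_iff] at hn; omega)).D,
    fun hn => (h.1 (by rw [Int.even_iff]; rw [Int.odd_iff] at hn; omega)).D⟩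

theorem HasParity.iterate_D {n : ℤ} {u : SuperFn Λ} (h : HasParity n u) (j : ℕ) :
    HasParity (n + j) (SuperFn.D^[j] u) := by
  induction j with
  | zero => simpa using h
  | succ j ih =>
    rw [Function.iterate_succ_apply', Nat.cast_succ, ← add_assoc]
    exact ih.D

theorem HasParity.sigma {n : ℤ} {u : SuperFn Λ} (h : HasParity n u) : HasParity n (sigma u) :=
  ⟨fun hn => by rw [h.1 hn]; exact h.1 hn, fun hn => by rw [h.2 hn]; exact (h.2 hn).neg⟩

theorem HasParity.twist {n : ℤ} {u : SuperFn Λ} (h : HasParity n u) (m : ℤ) :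
    HasParity n (twist m u) := by
  rw [SuperFn.twist]
  split_ifs
  exacts [h, h.sigma]

theorem twist_of_even {n : ℤ} (h : Even n) (u : SuperFn Λ) : twist n u = u := if_pos h

theorem twist_of_odd {n : ℤ} (h : Odd n) (u : SuperFn Λ) : twist n u = sigma u :=
  if_neg (Int.not_even_iff_odd.2 h)

theorem sigma_twist (n : ℤ) (u : SuperFn Λ) : sigma (twist n u) = twist (n + 1) u := by
  rcases Int.even_or_odd n with h | h
  · rw [twist_of_even h, twist_of_odd h.add_one]
  · rw [twist_of_odd h, twist_of_even h.add_one, sigma_sigma]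

theorem twist_twist (n m : ℤ) (u : SuperFn Λ) : twist n (twist m u) = twist (n + m) u := by
  rcases Int.even_or_odd n with h | h <;> rcases Int.even_or_odd m with h' | h'
  · rw [twist_of_even h, twist_of_even h', twist_of_even (h.add h')]
  · rw [twist_of_even h, twist_of_odd h', twist_of_odd (h.add_odd h')]
  · rw [twist_of_odd h, twist_of_even h', twist_of_odd (h.add_even h')]
  · rw [twist_of_odd h, twist_of_odd h', twist_of_even (h.add_odd h'), sigma_sigma]

theorem twist_mul (n : ℤ) (u v : SuperFn Λ) : twist n (u * v) = twist n u * twist n v := by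
  rcases Int.even_or_odd n with h | h
  · simp only [twist_of_even h]
  · simp only [twist_of_odd h, sigma_mul]

theorem sigma_iterate_D (j : ℕ) (u : SuperFn Λ) :
    sigma (D^[j] u) = (-1 : ℤ) ^ j • D^[j] (sigma u) := by
  induction j generalizing u with
  | zero => simp
  | succ j ih =>
    rw [Function.iterate_succ_apply, ih, sigma_D, Function.iterate_succ_apply]
    have h : D^[j] (-D (sigma u)) = -D^[j] (D (sigma u)) := by
      rw [← neg_one_smul ℂ (D (sigma u)), ← neg_one_smul ℂ (D^[j] (D (sigma u)))]
      have := map_smul (DLin (Λ := Λ) ^ j) (-1 : ℂ) (D (sigma u))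
      rwa [Module.End.pow_apply, Module.End.pow_apply] at this
    rw [h, pow_succ, smul_neg, mul_neg_one, neg_smul]

theorem iterate_D_neg (j : ℕ) (u : SuperFn Λ) : D^[j] (-u) = -D^[j] u := by
  have := map_neg (DLin (Λ := Λ) ^ j) u
  rwa [Module.End.pow_apply, Module.End.pow_apply] at this

/-- The Leibniz rule for the powers of `D_θ`. -/
theorem iterate_D_mul (j : ℕ) (u v : SuperFn Λ) :
    D^[j] (u * v) = ∑ k ∈ Finset.range (j + 1),
      superBinom j k • (D^[k] (twist (j - k) u) * D^[j - k] v) := by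
  induction j with
  | zero => simp [superBinom_zero_right, twist]
  | succ j ih =>
    set T : ℕ → SuperFn Λ := fun k => D^[k] (twist ((j + 1 : ℕ) - k) u) * D^[j + 1 - k] v with hT
    -- The graded Leibniz rule puts the new derivative on the first factor, or on the second one
    -- after a `sigma`; moving that `sigma` through $D_\theta^k$ yields $(-1)^k$ and one more twist.
    have hstep : ∀ k ∈ Finset.range (j + 1),
        D (superBinom j k • (D^[k] (twist (j - k) u) * D^[j - k] v)) =
          superBinom j k • T (k + 1) + ((-1) ^ k * superBinom j k) • T k := by
      intro k hk
      have hk' : j - k + 1 = j + 1 - k := by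
        have := Finset.mem_range.1 hk
        omega
      have h1 : D (superBinom j k • (D^[k] (twist (j - k) u) * D^[j - k] v)) =
          superBinom j k • D (D^[k] (twist (j - k) u) * D^[j - k] v) := map_zsmul DLin _ _
      rw [h1, D_mul, smul_add, sigma_iterate_D, sigma_twist, ← Function.iterate_succ_apply' D,
        ← Function.iterate_succ_apply' D, Nat.succ_eq_add_one, Nat.succ_eq_add_one, hk',
        smul_mul_assoc, smul_smul, mul_comm (superBinom j k)]
      simp only [hT]
      rw [Nat.add_sub_add_right]
      rw [show ((j + 1 : ℕ) : ℤ) - (k + 1 : ℕ) = j - k by push_cast; ring,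
        show ((j + 1 : ℕ) : ℤ) - k = j - k + 1 by push_cast; ring]
    have hsum : D (∑ k ∈ Finset.range (j + 1),
        superBinom j k • (D^[k] (twist (j - k) u) * D^[j - k] v)) = ∑ k ∈ Finset.range (j + 1),
          D (superBinom j k • (D^[k] (twist (j - k) u) * D^[j - k] v)) := map_sum DLin _ _
    rw [Function.iterate_succ_apply', ih, hsum, Finset.sum_congr rfl hstep,
      Finset.sum_add_distrib]
    -- Index shift towards Pascal's rule: the term `k = 0` is split off, and the additional top term
    -- is zero by `superBinom_self_succ`.
    have h2 : ∑ k ∈ Finset.range (j + 1), ((-1) ^ k * superBinom j k) • T k =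
        ∑ k ∈ Finset.range (j + 1), ((-1) ^ (k + 1) * superBinom j (k + 1)) • T (k + 1) + T 0 := by
      have h3 := Finset.sum_range_succ (fun k => ((-1) ^ k * superBinom j k) • T k) (j + 1)
      rw [superBinom_self_succ, mul_zero, zero_smul, add_zero] at h3
      rw [← h3, Finset.sum_range_succ', superBinom_zero_right, pow_zero, one_mul, one_smul]
    rw [h2, Finset.sum_range_succ' _ (j + 1), superBinom_zero_right, one_smul, ← add_assoc,
      ← Finset.sum_add_distrib]
    congr 1
    refine Finset.sum_congr rfl fun k _ => ?_
    rw [superBinom_succ_succ, add_smul]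

/-! ### Adjoints with respect to the pairing -/

/-- In passing from `j` to `j + 1`, integration by parts contributes $-1$ and the commutation of
`sigma` with $D_\theta^j$ contributes $(-1)^j$. The exponents $1,\dots,j$ add up to $j(j+1)/2$. -/
theorem integral_iterate_D_mul [CompleteSpace Λ] (j : ℕ) (u v : SuperFn Λ) :
    integral (D^[j] u * v) =
      (-1 : ℤ) ^ (j * (j + 1) / 2) • integral (twist j u * D^[j] v) := by
  induction j generalizing u v with
  | zero => simp [twist]
  | succ j ih =>
    have hs : ∀ (c : ℤ) (w : SuperFn Λ), integral (c • w) = c • integral w := fun c w =>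
      map_zsmul integralLin c w
    have he : (j + 1) * (j + 1 + 1) / 2 = j * (j + 1) / 2 + (j + 1) := by
      rw [show (j + 1) * (j + 1 + 1) = j * (j + 1) + (j + 1) * 2 by ring,
        Nat.add_mul_div_right _ _ two_pos]
    rw [Function.iterate_succ_apply', integral_D_mul, sigma_iterate_D, smul_mul_assoc, hs, he]
    have h1 : integral (D^[j] (sigma u) * D v) =
        (-1 : ℤ) ^ (j * (j + 1) / 2) • integral (twist (j + 1 : ℕ) u * D^[j + 1] v) := by
      have h2 : twist j (sigma u) = twist (j + 1 : ℕ) u := by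
        rw [← twist_of_odd odd_one u, twist_twist, Nat.cast_succ]
      rw [ih, h2, Function.iterate_succ_apply]
    rw [h1, smul_smul, ← neg_smul]
    congr 1
    ring

end SuperFn

end

/-! ### Bilinearity of the pairing, adjoints, and the exchange of kernels. -/

section

open SuperFn

variable {Λ : Type*} [NormedRing Λ] [NormedAlgebra ℂ Λ] [CommSuperalgebra Λ]

namespace SuperFn

theorem integral_zsmul (c : ℤ) (u : SuperFn Λ) : integral (c • u) = c • integral u :=
  map_zsmul integralLin c u

theorem sigma_zsmul (c : ℤ) (u : SuperFn Λ) : sigma (c • u) = c • sigma u :=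
  map_zsmul sigmaLin c u

/-- The pairing as a bilinear map. -/
def pairingLin : SuperFn Λ →ₗ[ℂ] SuperFn Λ →ₗ[ℂ] Λ :=
  LinearMap.mk₂ ℂ pairing
    (fun u v w => by rw [pairing, add_mul, integral_add]; rfl)
    (fun c u v => by
      rw [pairing, smul_mul_assoc]
      exact map_smul integralLin c _)
    (fun u v w => by rw [pairing, sigma_add, mul_add, integral_add]; rfl)
    (fun c u v => by
      rw [pairing, sigma_smul, mul_smul_comm]
      exact map_smul integralLin c _)

theorem pairing_add_left (u v w : SuperFn Λ) :
    pairing (u + v) w = pairing u w + pairing v w := pairingLin.map_add₂ u v w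
theorem pairing_add_right (u v w : SuperFn Λ) :
    pairing u (v + w) = pairing u v + pairing u w := map_add (pairingLin u) v w
theorem pairing_sum_left {ι : Type*} (s : Finset ι) (u : ι → SuperFn Λ) (w : SuperFn Λ) :
    pairing (∑ i ∈ s, u i) w = ∑ i ∈ s, pairing (u i) w := pairingLin.map_sum₂ s u w
theorem pairing_sum_right {ι : Type*} (s : Finset ι) (u : SuperFn Λ) (w : ι → SuperFn Λ) :
    pairing u (∑ i ∈ s, w i) = ∑ i ∈ s, pairing u (w i) := map_sum (pairingLin u) w s
theorem pairing_neg_left (u v : SuperFn Λ) : pairing (-u) v = -pairing u v :=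
  pairingLin.map_neg₂ u v
theorem pairing_neg_right (u v : SuperFn Λ) : pairing u (-v) = -pairing u v :=
  map_neg (pairingLin u) v
theorem pairing_zero_left (v : SuperFn Λ) : pairing 0 v = 0 := pairingLin.map_zero₂ v
theorem pairing_zero_right (u : SuperFn Λ) : pairing u 0 = 0 := map_zero (pairingLin u)

/-- The adjoint of `a D_θ^j` for `a` of parity `j`. -/
theorem pairing_mul_iterate_D [CompleteSpace Λ] {j : ℕ} {a : SuperFn Λ} (ha : HasParity j a)
    (w z : SuperFn Λ) :
    pairing (a * D^[j] w) z = pairing w ((-1 : ℤ) ^ (j * (j - 1) / 2) • D^[j] (a * z)) := by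
  -- The exponents of the adjoint and of integration by parts differ by `j`; the factor $(-1)^j$ is
  -- produced by moving the `sigma` of the pairing through $D_\theta^j$.
  have he : (-1 : ℤ) ^ (j * (j - 1) / 2) = (-1) ^ j * (-1) ^ (j * (j + 1) / 2) := by
    rw [← pow_add]
    rcases j with _ | j
    · simp
    · rw [show (j + 1) * (j + 1 + 1) = (j + 1) * j + (j + 1) * 2 by ring,
        Nat.add_mul_div_right _ _ two_pos, Nat.add_sub_cancel, ← add_assoc, add_right_comm,
        pow_add _ (j + 1 + (j + 1)), Even.neg_one_pow ⟨j + 1, rfl⟩, one_mul]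
  have hr : pairing w ((-1 : ℤ) ^ (j * (j - 1) / 2) • D^[j] (a * z)) =
      (-1 : ℤ) ^ (j * (j + 1) / 2) • integral (w * D^[j] (sigma (a * z))) := by
    rw [pairing, he, mul_comm, sigma_zsmul, sigma_iterate_D, smul_smul, mul_assoc,
      ← pow_add, Even.neg_one_pow ⟨j, rfl⟩, mul_one, mul_smul_comm, integral_zsmul]
  rw [hr, pairing]
  rcases Nat.even_or_odd j with hj | hj
  · have hae := ha.1 (by exact_mod_cast hj)
    rw [hae.mul_comm, mul_assoc, integral_iterate_D_mul, twist_of_even (by exact_mod_cast hj),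
      sigma_mul, hae]
  · have hao := ha.2 (by exact_mod_cast hj)
    rw [hao.mul_comm, mul_assoc, sigma_iterate_D, hj.neg_one_pow, neg_one_smul, neg_mul,
      integral_neg, integral_iterate_D_mul, twist_of_odd (by exact_mod_cast hj), sigma_sigma,
      sigma_mul, hao, neg_mul, iterate_D_neg, mul_neg, integral_neg, smul_neg]

variable [CompleteSpace Λ]

/-- The adjoint of `u D_θ⁻¹ v`, when this operator is even. -/
theorem pairing_kerAct {u v : SuperFn Λ} (h : u.IsEven ∧ v.IsOdd ∨ u.IsOdd ∧ v.IsEven)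
    (w z : SuperFn Λ) : pairing (kerAct u v w) z = pairing w (kerAdj u v z) := by
  rw [pairing, pairing, kerAct, kerAdj]
  rcases h with ⟨hu, hv⟩ | ⟨hu, hv⟩
  · have h1 : u * sigma z = sigma (u * z) := by rw [sigma_mul, hu]
    have h2 : v * sigma w = w * v := by rw [hv.mul_comm, sigma_sigma]
    rw [hu.mul_comm, mul_assoc, integral_Dinv_mul, h1, Dinv_sigma, sigma_mul, hv, neg_mul, neg_mul_neg, h2,
      sigma_neg, sigma_mul, hv, neg_mul, neg_neg, mul_assoc]
  · have h1 : u * sigma z = sigma (-(u * z)) := by rw [sigma_neg, sigma_mul, hu, neg_mul, neg_neg]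
    have h2 : sigma (Dinv (v * w)) = Dinv (-sigma (v * w)) := by
      rw [Dinv_neg, Dinv_sigma, neg_neg]
    rw [hu.mul_comm, mul_assoc, h2, integral_Dinv_mul, h1, Dinv_sigma, Dinv_neg, sigma_neg,
      sigma_neg, neg_neg, sigma_sigma, hv.mul_comm, sigma_neg, sigma_mul, hv, neg_mul, mul_neg,
      mul_assoc]

/-- Exchange of the first factors of `b D_θ⁻¹` and `w D_θ⁻¹`. -/
theorem Dinv_mul_sigma {n : ℤ} {w z : SuperFn Λ} (b : SuperFn Λ) (hw : HasParity n w)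
    (hz : HasParity (n + 1) z) : Dinv (b * w) * sigma z = sigma (z * Dinv (w * b)) := by
  rw [sigma_mul]
  rcases Int.even_or_odd n with hn | hn
  · have hw := hw.1 hn
    have hz := hz.2 hn.add_one
    rw [← hw.mul_comm, hz, neg_mul, mul_neg, hz.mul_comm, sigma_sigma]
  · have hw := hw.2 hn
    have hz := hz.1 hn.add_one
    have h1 : b * w = -sigma (w * b) := by
      rw [sigma_mul, hw, neg_mul, neg_neg, hw.mul_comm, sigma_sigma]
    rw [h1, hz, Dinv_neg, Dinv_sigma, neg_neg, hz.mul_comm]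

/-- Both sides integrate `a` times the same function, by graded commutativity under $D_\theta^{-1}$
and of the outer factors. With `a` the variation of the left factor of $aD_\theta^{-1}b$, this
isolates the variation and leaves the adjoint of $wD_\theta^{-1}z$ acting on `b`. -/
theorem pairing_kerAct_exchange_left {n : ℤ} {w z : SuperFn Λ} (a b : SuperFn Λ)
    (hw : HasParity n w) (hz : HasParity (n + 1) z) :
    pairing (kerAct a b w) z = pairing a (-kerAdj w z b) := by
  rw [pairing, pairing, kerAct, kerAdj, neg_neg, mul_assoc, Dinv_mul_sigma b hw hz]

/-- The counterpart for a variation `b` of the right factor: the adjoint of $aD_\theta^{-1}b$ brings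
`b` out of the argument of $D_\theta^{-1}$, and then the same commutation applies. -/
theorem pairing_kerAct_exchange_right {a b : SuperFn Λ}
    (h : a.IsEven ∧ b.IsOdd ∨ a.IsOdd ∧ b.IsEven) (w z : SuperFn Λ) :
    pairing (kerAct a b w) z = pairing (-kerAct w z a) b := by
  rw [pairing_kerAct h, pairing, pairing, kerAct, kerAdj, sigma_neg, mul_neg, neg_mul, mul_assoc]
  rcases h with ⟨ha, hb⟩ | ⟨ha, hb⟩
  · rw [Dinv_mul_sigma z ha.hasParity hb.hasParity]
  · rw [Dinv_mul_sigma z ha.hasParity (hb.hasParity.congr (by decide))]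

end SuperFn

/-! ### Formal operators -/

theorem IsOperator.add {a b : ℤ → SuperFn Λ} (ha : IsOperator a) (hb : IsOperator b) :
    IsOperator (a + b) := by
  obtain ⟨⟨m, hm⟩, ha⟩ := ha
  obtain ⟨⟨m', hm'⟩, hb⟩ := hb
  refine ⟨⟨max m m', fun j hj => ?_⟩, fun j => HasParity.add (ha j) (hb j)⟩
  rw [Pi.add_apply, hm j (lt_of_le_of_lt (le_max_left _ _) hj),
    hm' j (lt_of_le_of_lt (le_max_right _ _) hj), add_zero]

theorem IsOperator.neg {a : ℤ → SuperFn Λ} (ha : IsOperator a) : IsOperator (-a) := by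
  obtain ⟨⟨m, hm⟩, ha⟩ := ha
  exact ⟨⟨m, fun j hj => by rw [Pi.neg_apply, hm j hj, neg_zero]⟩, fun j => HasParity.neg (ha j)⟩

theorem IsOperator.zero : IsOperator (0 : ℤ → SuperFn Λ) :=
  ⟨⟨0, fun _ _ => rfl⟩, fun j => HasParity.zero j⟩

theorem IsOperator.sum {ι : Type*} {s : Finset ι} {a : ι → ℤ → SuperFn Λ}
    (h : ∀ i ∈ s, IsOperator (a i)) : IsOperator (∑ i ∈ s, a i) :=
  Finset.sum_induction a IsOperator (fun _ _ => IsOperator.add) IsOperator.zero h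

theorem iterate_D_zero (k : ℕ) : D^[k] (0 : SuperFn Λ) = 0 :=
  Function.iterate_fixed (map_zero DLin) k

theorem twist_zero_right (n : ℤ) : twist n (0 : SuperFn Λ) = 0 := by
  simp [twist, sigma_zero]

theorem IsOperator.comp {a b : ℤ → SuperFn Λ} (ha : IsOperator a) (hb : IsOperator b) :
    IsOperator (comp a b) := by
  obtain ⟨⟨m, hm⟩, ha⟩ := ha
  obtain ⟨⟨m', hm'⟩, hb⟩ := hb
  refine ⟨⟨m + m', fun n hn => ?_⟩, fun n => HasParity.finsum fun p => ?_⟩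
  · rw [SuperLax.comp]
    refine (finsum_congr fun p => ?_).trans finsum_zero
    split_ifs with h
    · rcases le_or_gt p.1 m with h1 | h1
      · have h2 : b p.2 = 0 := hm' _ (by omega)
        rw [h2, twist_zero_right, iterate_D_zero, mul_zero, smul_zero]
      · rw [hm _ h1, zero_mul, smul_zero]
    · rfl
  · split_ifs with h
    -- The summand has parity $i+j+(i+j-n)$, which is congruent to $n$ modulo 2.
    · refine HasParity.zsmul ((HasParity.mul (ha p.1) ((HasParity.twist (hb p.2) _).iterate_D _)).congr ?_) _
      rw [Int.toNat_of_nonneg (by omega)]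
      exact ⟨p.1 + p.2 - n, by ring⟩
    · exact HasParity.zero n

theorem IsOperator.comm {a b : ℤ → SuperFn Λ} (ha : IsOperator a) (hb : IsOperator b) :
    IsOperator (comm a b) := by
  rw [SuperLax.comm, sub_eq_add_neg]
  exact (ha.comp hb).add (hb.comp ha).neg

theorem IsOperator.plus {a : ℤ → SuperFn Λ} (ha : IsOperator a) : IsDiffOperator (plus a) := by
  obtain ⟨⟨m, hm⟩, ha⟩ := ha
  refine ⟨⟨⟨m, fun j hj => ?_⟩, fun j => ?_⟩, fun j hj => if_neg (not_le.2 hj)⟩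
  · rw [SuperLax.plus, hm j hj, ite_self]
  · change HasParity j (SuperLax.plus a j)
    rw [SuperLax.plus]
    split_ifs
    exacts [ha j, HasParity.zero j]

theorem IsDiffOperator.neg {a : ℤ → SuperFn Λ} (ha : IsDiffOperator a) : IsDiffOperator (-a) :=
  ⟨ha.1.neg, fun j hj => by rw [Pi.neg_apply, ha.2 j hj, neg_zero]⟩

/-- The coefficients of `u D_θ⁻¹ v`. -/
theorem ker_apply_neg (u v : SuperFn Λ) (k : ℕ) :
    ker u v (-1 - k) = superBinom (-1) k • (u * D^[k] (twist (-1 - k) v)) := by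
  rw [ker, comp, finsum_eq_single _ ((-1, 0) : ℤ × ℤ)]
  · have h1 : (-1 : ℤ) + 0 - (-1 - k) = k := by ring
    rw [if_pos (by simp)]
    simp only [Pi.single_eq_same, h1, Int.toNat_natCast, sub_zero]
  · rintro ⟨i, j⟩ hij
    split_ifs with h
    · by_cases hi : i = -1
      · have hj : j ≠ 0 := fun hj => hij (by rw [hi, hj])
        simp only [Pi.single_eq_of_ne hj, twist_zero_right, iterate_D_zero, mul_zero, smul_zero]
      · simp only [Pi.single_eq_of_ne hi, zero_mul, smul_zero]
    · rfl

theorem ker_apply_of_nonneg (u v : SuperFn Λ) {n : ℤ} (hn : 0 ≤ n) : ker u v n = 0 := by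
  rw [ker, comp]
  refine (finsum_congr fun p => ?_).trans finsum_zero
  split_ifs with h
  · by_cases hi : p.1 = -1
    · have hj : p.2 ≠ 0 := by omega
      rw [Pi.single_eq_of_ne hj, twist_zero_right, iterate_D_zero, mul_zero, smul_zero]
    · rw [Pi.single_eq_of_ne hi, zero_mul, smul_zero]
  · rfl

theorem isOperator_ker {u v : SuperFn Λ} (h : u.IsEven ∧ v.IsOdd ∨ u.IsOdd ∧ v.IsEven) :
    IsOperator (ker u v) := by
  refine ⟨⟨-1, fun j hj => ker_apply_of_nonneg u v (by omega)⟩, fun j => ?_⟩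
  change HasParity j _
  rcases lt_or_ge j 0 with hj | hj
  · obtain ⟨k, rfl⟩ : ∃ k : ℕ, j = -1 - k := ⟨(-1 - j).toNat, by omega⟩
    rw [ker_apply_neg]
    refine HasParity.zsmul ?_ _
    rcases h with ⟨hu, hv⟩ | ⟨hu, hv⟩
    · exact (hu.hasParity.mul ((hv.hasParity.twist _).iterate_D k)).congr ⟨k + 1, by ring⟩
    · exact (hu.hasParity.mul ((hv.hasParity.twist _).iterate_D k)).congr ⟨k + 1, by ring⟩
  · rw [ker_apply_of_nonneg u v hj]
    exact HasParity.zero j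

theorem ker_neg_right (u v : SuperFn Λ) : ker u (-v) = -ker u v := by
  funext j
  rw [Pi.neg_apply]
  rcases lt_or_ge j 0 with hj | hj
  · obtain ⟨k, rfl⟩ : ∃ k : ℕ, j = -1 - k := ⟨(-1 - j).toNat, by omega⟩
    have ht : twist (-1 - k) (-v) = -twist (-1 - k) v := by
      rw [twist, twist]
      split_ifs
      exacts [rfl, sigma_neg v]
    simp only [ker_apply_neg, ht, iterate_D_neg, mul_neg, smul_neg]
  · simp only [ker_apply_of_nonneg _ _ hj, neg_zero]

/-- The residue of the product of an operator of negative order and a differential operator. -/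
theorem comp_residue {a A : ℤ → SuperFn Λ} {m : ℕ} (ha : ∀ j, 0 ≤ j → a j = 0)
    (hA : ∀ j : ℤ, m ≤ j → A j = 0) :
    comp a A (-1) = ∑ j ∈ Finset.range m, ∑ k ∈ Finset.range (j + 1),
      superBinom (-1 - k) (j - k) • (a (-1 - k) * D^[j - k] (twist (-1 - j) (A j))) := by
  classical
  -- The pair `(j, k)` stands for the product of $a_{-1-k}D_\theta^{-1-k}$ and $A_jD_\theta^j$; it
  -- can reach the order $-1$ only if `k ≤ j`.
  let e : (_ : ℕ) × ℕ → ℤ × ℤ := fun q => (-1 - q.2, q.1)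
  have he : Function.Injective e := by
    rintro ⟨j, k⟩ ⟨j', k'⟩ h
    simp only [e, Prod.mk.injEq] at h
    obtain rfl : j = j' := by omega
    obtain rfl : k = k' := by omega
    rfl
  rw [Finset.sum_sigma', comp, finsum_eq_sum_of_support_subset
    (s := ((Finset.range m).sigma fun j => Finset.range (j + 1)).image e), Finset.sum_image he.injOn]
  · refine Finset.sum_congr rfl fun q hq => ?_
    obtain ⟨h1, h2⟩ := Finset.mem_sigma.1 hq
    rw [Finset.mem_range] at h1 h2
    have h3 : (-1 - q.2 + q.1 - (-1) : ℤ).toNat = q.1 - q.2 := by omega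
    have h4 : (-1 : ℤ) ≤ -1 - q.2 + q.1 := by omega
    simp only [e, if_pos h4, h3]
  · intro p hp
    rw [Function.mem_support] at hp
    have hle : -1 ≤ p.1 + p.2 := by
      by_contra h
      exact hp (if_neg h)
    rw [if_pos hle] at hp
    have h1 : p.1 < 0 := by
      by_contra h
      exact hp (by rw [ha _ (not_lt.1 h), zero_mul, smul_zero])
    have h2 : p.2 < m := by
      by_contra h
      exact hp (by rw [hA _ (not_lt.1 h), twist_zero_right, iterate_D_zero, mul_zero, smul_zero])
    rw [Finset.mem_coe, Finset.mem_image]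
    refine ⟨⟨p.2.toNat, (-1 - p.1).toNat⟩, ?_, ?_⟩
    · simp only [Finset.mem_sigma, Finset.mem_range]
      omega
    · ext <;> simp only [e] <;> omega

end

section

open SuperFn

/-! ### Polynomial paths and their first-order expansions -/

section Jets

variable {E E' E'' : Type*} [AddCommGroup E] [Module ℂ E] [AddCommGroup E'] [Module ℂ E']
  [AddCommGroup E''] [Module ℂ E'']

/-- Polynomial paths in a complex vector space. -/
def PolyPath (E : Type*) [AddCommGroup E] [Module ℂ E] : Submodule ℂ (ℂ → E) :=
  Submodule.span ℂ (Set.range fun q : ℕ × E => fun ε : ℂ => ε ^ q.1 • q.2)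

theorem polyPath_monomial (n : ℕ) (c : E) : (fun ε : ℂ => ε ^ n • c) ∈ PolyPath E :=
  Submodule.subset_span ⟨(n, c), rfl⟩

theorem polyPath_const (c : E) : (fun _ : ℂ => c) ∈ PolyPath E := by
  simpa using polyPath_monomial 0 c

theorem PolyPath.map₂ (B : E →ₗ[ℂ] E' →ₗ[ℂ] E'') {F : ℂ → E} {G : ℂ → E'} (hF : F ∈ PolyPath E)
    (hG : G ∈ PolyPath E') : (fun ε => B (F ε) (G ε)) ∈ PolyPath E'' := by
  induction hF, hG using Submodule.span_induction₂ with
  | mem_mem x y hx hy =>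
    obtain ⟨⟨n, c⟩, rfl⟩ := hx
    obtain ⟨⟨m, d⟩, rfl⟩ := hy
    have h : (fun ε : ℂ => B (ε ^ n • c) (ε ^ m • d)) = fun ε => ε ^ (n + m) • B c d := by
      funext ε
      rw [map_smul, map_smul, LinearMap.smul_apply, smul_smul, pow_add, mul_comm]
    exact h ▸ polyPath_monomial (n + m) (B c d)
  | zero_left y hy =>
    simp only [Pi.zero_apply, map_zero, LinearMap.zero_apply]
    exact (PolyPath E'').zero_mem
  | zero_right x hx =>
    simp only [Pi.zero_apply, map_zero]
    exact (PolyPath E'').zero_mem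
  | add_left x y z _ _ _ h1 h2 =>
    simp only [Pi.add_apply, map_add, LinearMap.add_apply]
    exact (PolyPath E'').add_mem h1 h2
  | add_right x y z _ _ _ h1 h2 =>
    simp only [Pi.add_apply, map_add]
    exact (PolyPath E'').add_mem h1 h2
  | smul_left r x y _ _ h =>
    simp only [Pi.smul_apply, map_smul, LinearMap.smul_apply]
    exact (PolyPath E'').smul_mem r h
  | smul_right r x y _ _ h =>
    simp only [Pi.smul_apply, map_smul]
    exact (PolyPath E'').smul_mem r h

theorem PolyPath.smul_id {F : ℂ → E} (hF : F ∈ PolyPath E) : (fun ε => ε • F ε) ∈ PolyPath E := by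
  have h : (fun ε : ℂ => ε) ∈ PolyPath ℂ := by simpa using polyPath_monomial 1 (1 : ℂ)
  exact PolyPath.map₂ (LinearMap.lsmul ℂ E) h hF

theorem PolyPath.differentiable {A : Type*} [NormedAddCommGroup A] [NormedSpace ℂ A] {F : ℂ → A}
    (hF : F ∈ PolyPath A) : Differentiable ℂ F := by
  induction hF using Submodule.span_induction with
  | mem x hx =>
    obtain ⟨⟨n, c⟩, rfl⟩ := hx
    fun_prop
  | zero => exact differentiable_const 0
  | add x y _ _ hx hy => exact hx.add hy
  | smul r x _ hx => exact hx.const_smul r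

/-- The path `F` is polynomial and `F ε = F₀ + ε F₁ + O(ε²)`. -/
def HasJet (F : ℂ → E) (F₀ F₁ : E) : Prop :=
  ∃ R ∈ PolyPath E, ∀ ε, F ε = F₀ + ε • F₁ + ε • ε • R ε

theorem hasJet_linear (a b : E) : HasJet (fun ε => a + ε • b) a b :=
  ⟨0, (PolyPath E).zero_mem, fun ε => by simp⟩

theorem HasJet.add {F G : ℂ → E} {F₀ F₁ G₀ G₁ : E} (hF : HasJet F F₀ F₁) (hG : HasJet G G₀ G₁) :
    HasJet (fun ε => F ε + G ε) (F₀ + G₀) (F₁ + G₁) := by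
  obtain ⟨R, hR, hF⟩ := hF
  obtain ⟨S, hS, hG⟩ := hG
  refine ⟨R + S, (PolyPath E).add_mem hR hS, fun ε => ?_⟩
  simp only [hF, hG, Pi.add_apply, smul_add]
  abel

theorem HasJet.sum {ι : Type*} (s : Finset ι) {F : ι → ℂ → E} {F₀ F₁ : ι → E}
    (h : ∀ i ∈ s, HasJet (F i) (F₀ i) (F₁ i)) :
    HasJet (fun ε => ∑ i ∈ s, F i ε) (∑ i ∈ s, F₀ i) (∑ i ∈ s, F₁ i) := by
  classical
  induction s using Finset.induction_on with
  | empty => exact ⟨0, (PolyPath E).zero_mem, fun ε => by simp⟩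
  | insert i s hi ih =>
    simp only [Finset.sum_insert hi]
    exact (h i (Finset.mem_insert_self i s)).add
      (ih fun j hj => h j (Finset.mem_insert_of_mem hj))

theorem HasJet.map₂ (B : E →ₗ[ℂ] E' →ₗ[ℂ] E'') {F : ℂ → E} {G : ℂ → E'} {F₀ F₁ : E} {G₀ G₁ : E'}
    (hF : HasJet F F₀ F₁) (hG : HasJet G G₀ G₁) :
    HasJet (fun ε => B (F ε) (G ε)) (B F₀ G₀) (B F₀ G₁ + B F₁ G₀) := by
  obtain ⟨R, hR, hF⟩ := hF
  obtain ⟨S, hS, hG⟩ := hG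
  -- The terms of order at least two in the product of the two expansions, divided by
  -- $\varepsilon^2$.
  refine ⟨fun ε => B F₀ (S ε) + B (R ε) G₀ + B F₁ G₁ + ε • (B F₁ (S ε) + B (R ε) G₁) +
    ε • ε • B (R ε) (S ε), ?_, fun ε => ?_⟩
  · have h1 := PolyPath.map₂ B (polyPath_const F₀) hS
    have h2 := PolyPath.map₂ B hR (polyPath_const G₀)
    have h3 := PolyPath.map₂ B (polyPath_const F₁) (polyPath_const G₁)
    have h4 := PolyPath.map₂ B (polyPath_const F₁) hS
    have h5 := PolyPath.map₂ B hR (polyPath_const G₁)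
    have h6 := PolyPath.map₂ B hR hS
    exact ((PolyPath E'').add_mem ((PolyPath E'').add_mem ((PolyPath E'').add_mem
      ((PolyPath E'').add_mem h1 h2) h3) (PolyPath.smul_id ((PolyPath E'').add_mem h4 h5)))
      (by simpa only [mul_smul] using PolyPath.smul_id (PolyPath.smul_id h6)))
  · simp only [hF, hG, map_add, map_smul, LinearMap.add_apply, LinearMap.smul_apply, smul_add]
    module

theorem HasJet.map (L : E →ₗ[ℂ] E') {F : ℂ → E} {F₀ F₁ : E} (hF : HasJet F F₀ F₁) :
    HasJet (fun ε => L (F ε)) (L F₀) (L F₁) := by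
  obtain ⟨R, hR, hF⟩ := hF
  -- A linear map is treated as a bilinear one whose first argument is the constant path 1.
  have h := PolyPath.map₂ (LinearMap.toSpanSingleton ℂ (E →ₗ[ℂ] E') L)
    (polyPath_const (1 : ℂ)) hR
  simp only [LinearMap.toSpanSingleton_apply, one_smul] at h
  exact ⟨_, h, fun ε => by simp only [hF, map_add, map_smul]⟩

/-- A polynomial remainder is differentiable, so $\varepsilon^2R(\varepsilon)$ has derivative zero
at the origin. This converts the algebraic expansion into an actual derivative, for paths in a
normed space such as $\Lambda$. -/
theorem HasJet.hasDerivAt {A : Type*} [NormedAddCommGroup A] [NormedSpace ℂ A] {F : ℂ → A}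
    {F₀ F₁ : A} (h : HasJet F F₀ F₁) : HasDerivAt F F₁ 0 := by
  obtain ⟨R, hR, hF⟩ := h
  have hR' := (PolyPath.differentiable hR 0).hasDerivAt
  have h1 := ((hasDerivAt_id (0 : ℂ)).smul_const F₁).const_add F₀
  have h2 := (hasDerivAt_id (0 : ℂ)).smul ((hasDerivAt_id (0 : ℂ)).smul hR')
  have h3 := h1.add h2
  rw [funext hF]
  refine h3.congr_deriv ?_
  simp

end Jets

variable {Λ : Type*} [NormedRing Λ] [NormedAlgebra ℂ Λ] [CommSuperalgebra Λ]

/-! ### Differential operators -/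

theorem diffAct_eq_sum {a : ℤ → SuperFn Λ} {m : ℕ} (ha : ∀ j : ℤ, m ≤ j → a j = 0)
    (h : SuperFn Λ) : diffAct a h = ∑ j ∈ Finset.range m, a j * D^[j] h := by
  refine finsum_eq_sum_of_support_subset _ fun j hj => ?_
  rw [Finset.mem_coe, Finset.mem_range]
  by_contra hjm
  exact hj (by simp only [ha j (by omega), zero_mul])

theorem diffAdj_eq_sum {a : ℤ → SuperFn Λ} {m : ℕ} (ha : ∀ j : ℤ, m ≤ j → a j = 0)
    (h : SuperFn Λ) : diffAdj a h =
      ∑ j ∈ Finset.range m, (-1 : ℤ) ^ (j * (j - 1) / 2) • D^[j] (a j * h) := by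
  refine finsum_eq_sum_of_support_subset _ fun j hj => ?_
  rw [Finset.mem_coe, Finset.mem_range]
  by_contra hjm
  exact hj (by simp only [ha j (by omega), zero_mul, iterate_D_zero, smul_zero])

/-- Every larger bound is admitted as well, so that several operators can be expanded over a common
range. -/
theorem IsOperator.exists_bound {a : ℤ → SuperFn Λ} (ha : IsOperator a) :
    ∃ m : ℕ, ∀ n : ℕ, m ≤ n → ∀ j : ℤ, n ≤ j → a j = 0 := by
  obtain ⟨m, hm⟩ := ha.1
  exact ⟨(m + 1).toNat, fun n hn j hj => hm j (by omega)⟩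

theorem hasParity_diffAct {a : ℤ → SuperFn Λ} (ha : IsOperator a) {n : ℤ} {h : SuperFn Λ}
    (hh : HasParity n h) : HasParity n (diffAct a h) :=
  HasParity.finsum fun j => (HasParity.mul (ha.2 j) (hh.iterate_D j)).congr ⟨j, by ring⟩

theorem hasParity_diffAdj {a : ℤ → SuperFn Λ} (ha : IsOperator a) {n : ℤ} {h : SuperFn Λ}
    (hh : HasParity n h) : HasParity n (diffAdj a h) :=
  HasParity.finsum fun j =>
    (((HasParity.mul (ha.2 j) hh).iterate_D j).congr ⟨j, by ring⟩).zsmul _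

theorem pairing_diffAct [CompleteSpace Λ] {a : ℤ → SuperFn Λ} (ha : IsOperator a)
    (w z : SuperFn Λ) : pairing (diffAct a w) z = pairing w (diffAdj a z) := by
  obtain ⟨m, hm⟩ := ha.exists_bound
  rw [diffAct_eq_sum (hm m le_rfl), diffAdj_eq_sum (hm m le_rfl), pairing_sum_left,
    pairing_sum_right]
  exact Finset.sum_congr rfl fun j _ => pairing_mul_iterate_D (ha.2 j) w z

/-- Identifies the sign in the expansion of $D_\theta^{-1}\circ u$ with the sign in the adjoint of
$aD_\theta^j$. -/
theorem neg_one_pow_half (j : ℕ) : (-1 : ℤ) ^ (j / 2) = (-1) ^ (j * (j - 1) / 2) := by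
  rcases Nat.even_or_odd' j with ⟨m, rfl | rfl⟩
  · rcases m with _ | m
    · rfl
    · rw [show 2 * (m + 1) * (2 * (m + 1) - 1) / 2 = (m + 1) + 2 * (m * (m + 1)) by
        rw [mul_assoc, Nat.mul_div_cancel_left _ two_pos, show 2 * (m + 1) - 1 = 2 * m + 1 by omega]
        ring, Nat.mul_div_cancel_left _ two_pos, pow_add _ (m + 1), pow_mul _ 2]
      simp
  · rw [show (2 * m + 1) * (2 * m + 1 - 1) / 2 = m + 2 * (m * m) by
        rw [Nat.add_sub_cancel, mul_comm, mul_assoc, Nat.mul_div_cancel_left _ two_pos]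
        ring, show (2 * m + 1) / 2 = m by omega, pow_add, pow_mul _ 2]
    simp

/-- `(w D_θ⁻¹ z, A) = ⟨w, A⋆ z⟩` for a differential operator `A`. -/
theorem opPairing_ker {A : ℤ → SuperFn Λ} (hA : IsOperator A) (w z : SuperFn Λ) :
    opPairing (ker w z) A = pairing w (diffAdj A z) := by
  obtain ⟨m, hm⟩ := hA.exists_bound
  rw [opPairing, comp_residue (fun j => ker_apply_of_nonneg w z) (hm m le_rfl),
    diffAdj_eq_sum (hm m le_rfl), pairing_sum_right]
  refine (map_sum integralLin _ _).trans (Finset.sum_congr rfl fun j _ => ?_)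
  change integral _ = _
  -- The coefficient form of $(wD_\theta^{-1}z)\circ
  -- A_jD_\theta^j=wD_\theta^{-1}\circ(zA_j)D_\theta^j$: by the Leibniz rule the residue collapses
  -- to one derivative of $zA_j$.
  have h1 : ∑ k ∈ Finset.range (j + 1), superBinom (-1 - k) (j - k) •
      (ker w z (-1 - k) * D^[j - k] (twist (-1 - j) (A j))) =
      superBinom (-1) j • (w * D^[j] (twist (-1 - j) (z * A j))) := by
    rw [twist_mul, iterate_D_mul, Finset.mul_sum, Finset.smul_sum]
    refine Finset.sum_congr rfl fun k hk => ?_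
    have hkj : k ≤ j := Nat.lt_succ_iff.1 (Finset.mem_range.1 hk)
    rw [ker_apply_neg, twist_twist, show (j - k + (-1 - j) : ℤ) = -1 - k by ring, smul_mul_assoc,
      smul_smul, mul_smul_comm, smul_smul, ← superBinom_mul_superBinom hkj, mul_assoc,
      mul_comm (superBinom (-1) k)]
  rw [h1, integral_zsmul, superBinom_neg_one, neg_one_pow_half, pairing, sigma_zsmul,
    mul_smul_comm, integral_zsmul, sigma_iterate_D]
  congr 1
  have hp : HasParity j (A j) := hA.2 j
  rcases Nat.even_or_odd j with hj | hj
  · have he := hp.1 (by exact_mod_cast hj)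
    rw [twist_of_odd (by rw [Int.odd_iff]; rw [Nat.even_iff] at hj; omega), hj.neg_one_pow,
      one_smul, he.mul_comm]
  · have ho := hp.2 (by exact_mod_cast hj)
    rw [twist_of_even (by rw [Int.even_iff]; rw [Nat.odd_iff] at hj; omega), hj.neg_one_pow,
      neg_one_smul, ← iterate_D_neg, ho.mul_comm, sigma_mul, sigma_sigma, ho, mul_neg, neg_neg]

/-- The sum defining `comp` is a `finsum`, additive only under finiteness of supports. For left
factors of negative order `comp_residue` gives the residue as a finite sum over a range depending on
`A` alone, and this is linear in the left factor. -/
theorem opPairing_sum_left {ι : Type*} (s : Finset ι) {a : ι → ℤ → SuperFn Λ} {A : ℤ → SuperFn Λ}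
    (ha : ∀ i ∈ s, ∀ j, 0 ≤ j → a i j = 0) (hA : IsOperator A) :
    opPairing (∑ i ∈ s, a i) A = ∑ i ∈ s, opPairing (a i) A := by
  obtain ⟨m, hm⟩ := hA.exists_bound
  have h0 : ∀ j, 0 ≤ j → (∑ i ∈ s, a i) j = 0 := fun j hj => by
    rw [Finset.sum_apply]
    exact Finset.sum_eq_zero fun i hi => ha i hi j hj
  have h1 : ∀ i ∈ s, opPairing (a i) A = integralLin (∑ j ∈ Finset.range m,
      ∑ k ∈ Finset.range (j + 1),
        superBinom (-1 - k) (j - k) • (a i (-1 - k) * D^[j - k] (twist (-1 - j) (A j)))) :=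
    fun i hi => congrArg integral (comp_residue (ha i hi) (hm m le_rfl))
  rw [Finset.sum_congr rfl h1, ← map_sum, opPairing, comp_residue h0 (hm m le_rfl),
    Finset.sum_comm]
  refine congrArg integral (Finset.sum_congr rfl fun j _ => ?_)
  rw [Finset.sum_comm]
  refine Finset.sum_congr rfl fun k _ => ?_
  rw [Finset.sum_apply, Finset.sum_mul, Finset.smul_sum]

theorem opPairing_add_left {a b A : ℤ → SuperFn Λ} (ha : ∀ j, 0 ≤ j → a j = 0)
    (hb : ∀ j, 0 ≤ j → b j = 0) (hA : IsOperator A) :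
    opPairing (a + b) A = opPairing a A + opPairing b A := by
  have h := opPairing_sum_left (Finset.univ : Finset (Fin 2)) (a := ![a, b])
    (fun i _ => by fin_cases i <;> assumption) hA
  simpa using h

/-- Two operators of negative order have scalar product zero. -/
theorem opPairing_add_right {a A K : ℤ → SuperFn Λ} (ha : ∀ j, 0 ≤ j → a j = 0)
    (hK : ∀ j, 0 ≤ j → K j = 0) : opPairing a (A + K) = opPairing a A := by
  rw [opPairing, opPairing, comp, comp]
  congr 1
  refine finsum_congr fun p => ?_
  split_ifs with h
  · rcases lt_or_ge p.1 0 with h1 | h1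
    · rw [Pi.add_apply, hK p.2 (by omega), add_zero]
    · rw [ha _ h1, zero_mul, zero_mul]
  · rfl

theorem comp_zero_left (a : ℤ → SuperFn Λ) : comp 0 a = 0 := by
  funext n
  rw [comp]
  refine (finsum_congr fun p => ?_).trans finsum_zero
  rw [Pi.zero_apply, zero_mul, smul_zero, ite_self]

theorem comp_zero_right (a : ℤ → SuperFn Λ) : comp a 0 = 0 := by
  funext n
  rw [comp]
  refine (finsum_congr fun p => ?_).trans finsum_zero
  rw [Pi.zero_apply, twist_zero_right, iterate_D_zero, mul_zero, smul_zero, ite_self]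

theorem hasJet_mul {F G : ℂ → SuperFn Λ} {F₀ F₁ G₀ G₁ : SuperFn Λ} (hF : HasJet F F₀ F₁)
    (hG : HasJet G G₀ G₁) : HasJet (fun ε => F ε * G ε) (F₀ * G₀) (F₀ * G₁ + F₁ * G₀) :=
  HasJet.map₂ (LinearMap.mul ℂ (SuperFn Λ)) hF hG

theorem hasJet_diffAct {a b : ℤ → SuperFn Λ} (ha : IsOperator a) (hb : IsOperator b)
    {F : ℂ → SuperFn Λ} {F₀ F₁ : SuperFn Λ} (hF : HasJet F F₀ F₁) :
    HasJet (fun ε => diffAct (a + ε • b) (F ε)) (diffAct a F₀) (diffAct a F₁ + diffAct b F₀) := by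
  obtain ⟨m, hm⟩ := ha.exists_bound
  obtain ⟨m', hm'⟩ := hb.exists_bound
  have h1 := hm (max m m') (le_max_left _ _)
  have h2 := hm' (max m m') (le_max_right _ _)
  have h3 : ∀ ε : ℂ, ∀ j : ℤ, (max m m' : ℕ) ≤ j → (a + ε • b) j = 0 := fun ε j hj => by
    rw [Pi.add_apply, Pi.smul_apply, h1 j hj, h2 j hj, smul_zero, add_zero]
  simp only [fun ε => diffAct_eq_sum (h3 ε), diffAct_eq_sum h1, diffAct_eq_sum h2,
    ← Finset.sum_add_distrib]
  refine HasJet.sum _ fun j _ => hasJet_mul (hasJet_linear (a j) (b j)) ?_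
  have := hF.map (DLin (Λ := Λ) ^ j)
  simp only [Module.End.pow_apply] at this
  exact this

end

open SuperFn

variable {Λ : Type*} [NormedRing Λ] [NormedAlgebra ℂ Λ] [CommSuperalgebra Λ] [CompleteSpace Λ]
  {N : ℕ}

/-! ### Parities -/

theorem SuperFn.HasParity.Dinv {n : ℤ} {u : SuperFn Λ} (h : HasParity n u) :
    HasParity (n + 1) (Dinv u) := by
  refine ⟨fun hn => ?_, fun hn => ?_⟩
  · have hu := h.2 (by rw [Int.odd_iff]; rw [Int.even_iff] at hn; omega)
    have := Dinv_sigma u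
    rw [hu, Dinv_neg, neg_inj] at this
    exact this.symm
  · have hu := h.1 (by rw [Int.even_iff]; rw [Int.odd_iff] at hn; omega)
    have := Dinv_sigma u
    rw [hu] at this
    exact neg_eq_iff_eq_neg.1 this.symm

theorem hasParity_kerAct {m n : ℤ} {u v h : SuperFn Λ} (hu : HasParity m u)
    (hv : HasParity (m + 1) v) (hh : HasParity n h) : HasParity n (kerAct u v h) :=
  (hu.mul (hv.mul hh).Dinv).congr ⟨m + 1, by ring⟩

theorem hasParity_kerAdj {m n : ℤ} {u v h : SuperFn Λ} (hu : HasParity m u)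
    (hv : HasParity (m + 1) v) (hh : HasParity n h) : HasParity n (kerAdj u v h) :=
  ((hv.mul (hu.mul hh).Dinv).congr ⟨m + 1, by ring⟩).neg

theorem hasParity_lax {P : Tuple Λ N} (hP : IsPhase P)
    {n : ℤ} {h : SuperFn Λ} (hh : HasParity n h) : HasParity n (lax P h) := by
  refine (hasParity_diffAct hP.1.1 hh).add (HasParity.sum fun i _ => ?_)
  obtain ⟨hf, hΦs, hfs, hΦ⟩ := hP.2 i
  exact (hasParity_kerAct hf.hasParity hfs.hasParity hh).add
    (hasParity_kerAct hΦ.hasParity (hΦs.hasParity.congr (by decide)) hh)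

theorem hasParity_laxAdj {P : Tuple Λ N} (hP : IsPhase P)
    {n : ℤ} {h : SuperFn Λ} (hh : HasParity n h) :
    HasParity n (laxAdj P h) := by
  refine (hasParity_diffAdj hP.1.1 hh).add (HasParity.sum fun i _ => ?_)
  obtain ⟨hf, hΦs, hfs, hΦ⟩ := hP.2 i
  exact (hasParity_kerAdj hf.hasParity hfs.hasParity hh).add
    (hasParity_kerAdj hΦ.hasParity (hΦs.hasParity.congr (by decide)) hh)

theorem hasParity_lax_iterate {P : Tuple Λ N} (hP : IsPhase P)
    {n : ℤ} {h : SuperFn Λ} (hh : HasParity n h) (s : ℕ) :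
    HasParity n ((lax P)^[s] h) :=
  Function.Iterate.rec (HasParity n) hh (fun _ => hasParity_lax hP) s

theorem hasParity_laxAdj_iterate {P : Tuple Λ N} (hP : IsPhase P)
    {n : ℤ} {h : SuperFn Λ} (hh : HasParity n h) (s : ℕ) :
    HasParity n ((laxAdj P)^[s] h) :=
  Function.Iterate.rec (HasParity n) hh (fun _ => hasParity_laxAdj hP) s

theorem hasParity_MAct {P : Tuple Λ N} (hP : IsPhase P)
    (k : Fin N) (s : ℕ) {n : ℤ} {h : SuperFn Λ} (hh : HasParity n h) :
    HasParity n (MAct k s P h) := by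
  obtain ⟨hf, hΦs, hfs, hΦ⟩ := hP.2 k
  exact HasParity.sum fun p _ => (hasParity_kerAct (hasParity_lax_iterate hP hf.hasParity _)
    (hasParity_laxAdj_iterate hP hfs.hasParity _) hh).add
    (hasParity_kerAct (hasParity_lax_iterate hP hΦ.hasParity _)
    (hasParity_laxAdj_iterate hP (hΦs.hasParity.congr (by decide)) _) hh)

theorem hasParity_MAdj {P : Tuple Λ N} (hP : IsPhase P)
    (k : Fin N) (s : ℕ) {n : ℤ} {h : SuperFn Λ} (hh : HasParity n h) :
    HasParity n (MAdj k s P h) := by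
  obtain ⟨hf, hΦs, hfs, hΦ⟩ := hP.2 k
  exact HasParity.sum fun p _ => (hasParity_kerAdj (hasParity_lax_iterate hP hf.hasParity _)
    (hasParity_laxAdj_iterate hP hfs.hasParity _) hh).add
    (hasParity_kerAdj (hasParity_lax_iterate hP hΦ.hasParity _)
    (hasParity_laxAdj_iterate hP (hΦs.hasParity.congr (by decide)) _) hh)

theorem isOperator_M {P : Tuple Λ N} (hP : IsPhase P)
    (k : Fin N) (s : ℕ) : IsOperator (M k s P) := by
  obtain ⟨hf, hΦs, hfs, hΦ⟩ := hP.2 k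
  exact IsOperator.sum fun p _ => (isOperator_ker (Or.inl
    ⟨hasParity_zero_iff.1 (hasParity_lax_iterate hP hf.hasParity _),
      hasParity_one_iff.1 (hasParity_laxAdj_iterate hP hfs.hasParity _)⟩)).add
    (isOperator_ker (Or.inr
    ⟨hasParity_one_iff.1 (hasParity_lax_iterate hP hΦ.hasParity _),
      hasParity_zero_iff.1 (hasParity_laxAdj_iterate hP hΦs.hasParity _)⟩))

/-- `-M h + δ l^s h` has the parity of `h`. -/
theorem hasParity_neg_MAct_add {P : Tuple Λ N} (hP : IsPhase P) (k i : Fin N) (s : ℕ)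
    {n : ℤ} {h : SuperFn Λ}
    (hh : HasParity n h) :
    HasParity n (-MAct k s P h + if i = k then (lax P)^[s] h else 0) := by
  refine (hasParity_MAct hP k s hh).neg.add ?_
  split_ifs
  exacts [hasParity_lax_iterate hP hh s, HasParity.zero n]

theorem hasParity_neg_MAdj_add {P : Tuple Λ N} (hP : IsPhase P) (k i : Fin N) (s : ℕ)
    {n : ℤ} {h : SuperFn Λ}
    (hh : HasParity n h) :
    HasParity n (-MAdj k s P h + if i = k then (laxAdj P)^[s] h else 0) := by
  refine (hasParity_MAdj hP k s hh).neg.add ?_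
  split_ifs
  exacts [hasParity_laxAdj_iterate hP hh s, HasParity.zero n]

theorem isPhase_ghostFlow {P : Tuple Λ N} (hP : IsPhase P)
    (k : Fin N) (s : ℕ) : IsPhase (ghostFlow k s P) := by
  refine ⟨((isOperator_M hP k s).comm hP.1.1).plus.neg, fun i => ?_⟩
  obtain ⟨hf, hΦs, hfs, hΦ⟩ := hP.2 i
  have hneg : ∀ a b : SuperFn Λ, a - b = -(-a + b) := fun a b => by abel
  refine ⟨hasParity_zero_iff.1 (hasParity_neg_MAct_add hP k i s hf.hasParity),
    ?_, ?_, hasParity_one_iff.1 (hasParity_neg_MAct_add hP k i s hΦ.hasParity)⟩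
  · change IsEven (_ - _)
    rw [hneg]
    exact (hasParity_zero_iff.1 (hasParity_neg_MAdj_add hP k i s hΦs.hasParity)).neg
  · change IsOdd (_ - _)
    rw [hneg]
    exact (hasParity_one_iff.1 (hasParity_neg_MAdj_add hP k i s hfs.hasParity)).neg

theorem isCovector_eigenGrad {P : Tuple Λ N} (hP : IsPhase P)
    (k : Fin N) (s : ℕ) : IsCovector (eigenGrad k s P) := by
  refine ⟨isOperator_M hP k s, fun i => ?_⟩
  obtain ⟨hf, hΦs, hfs, hΦ⟩ := hP.2 i
  exact ⟨hasParity_one_iff.1 (hasParity_neg_MAdj_add hP k i s hfs.hasParity),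
    hasParity_one_iff.1 (hasParity_neg_MAct_add hP k i s hΦ.hasParity),
    hasParity_zero_iff.1 (hasParity_neg_MAct_add hP k i s hf.hasParity),
    hasParity_zero_iff.1 (hasParity_neg_MAdj_add hP k i s hΦs.hasParity)⟩

theorem pairing_lax {P : Tuple Λ N} (hP : IsPhase P)
    (w z : SuperFn Λ) : pairing (lax P w) z = pairing w (laxAdj P z) := by
  rw [lax, laxAdj, pairing_add_left, pairing_add_right, pairing_sum_left, pairing_sum_right,
    pairing_diffAct hP.1.1]
  congr 1
  refine Finset.sum_congr rfl fun i _ => ?_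
  obtain ⟨hf, hΦs, hfs, hΦ⟩ := hP.2 i
  rw [pairing_add_left, pairing_add_right, pairing_kerAct (Or.inl ⟨hf, hfs⟩),
    pairing_kerAct (Or.inr ⟨hΦ, hΦs⟩)]

/-! ### The Poisson structure -/

theorem M_apply_of_nonneg (k : Fin N) (s : ℕ) (P : Tuple Λ N) {j : ℤ} (hj : 0 ≤ j) :
    M k s P j = 0 := by
  rw [M, Finset.sum_apply]
  refine Finset.sum_eq_zero fun p _ => ?_
  rw [Pi.add_apply, ker_apply_of_nonneg _ _ hj, ker_apply_of_nonneg _ _ hj, add_zero]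

/-- As $M_k^s$ has no coefficients of nonnegative order, $(M_k^s)_+$ and its adjoint act as zero.
The flow of $f_i,\Phi_i$ is then the gradient in $f_i^*,\Phi_i^*$, and the flow of $f_i^*,\Phi_i^*$
is minus the gradient in $f_i,\Phi_i$; inserted into the kernels, these give the remaining part of
the equation for $l$. -/
theorem backlundDeriv_ghostFlow (k : Fin N) (s : ℕ) (P : Tuple Λ N) :
    backlundDeriv P (ghostFlow k s P) = -poisson P (eigenGrad k s P) := by
  have hplus : plus (M k s P) = 0 := by
    funext j
    rw [plus]
    split_ifs with hj
    exacts [M_apply_of_nonneg k s P hj, rfl]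
  have hact : ∀ h, diffAct (M k s P) h = 0 := fun h => by
    rw [diffAct_eq_sum (m := 0) fun j hj => M_apply_of_nonneg k s P (by simpa using hj)]
    rfl
  have hadj : ∀ h, diffAdj (M k s P) h = 0 := fun h => by
    rw [diffAdj_eq_sum (m := 0) fun j hj => M_apply_of_nonneg k s P (by simpa using hj)]
    rfl
  have hneg : ∀ a b : SuperFn Λ, a - b = -(-a + b) := fun a b => by abel
  ext1
  · change -plus (comm (M k s P) P.op) + _ =
      -(comm P.op (plus (M k s P)) - plus (comm P.op (M k s P)) + _)
    have h1 : comm P.op (M k s P) = -comm (M k s P) P.op := (neg_sub _ _).symm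
    have h2 : plus (-comm (M k s P) P.op) = -plus (comm (M k s P) P.op) := by
      funext j
      simp only [plus, Pi.neg_apply]
      split_ifs
      exacts [rfl, neg_zero.symm]
    have h3 : comm P.op (0 : ℤ → SuperFn Λ) = 0 := by
      rw [comm, comp_zero_left, comp_zero_right, sub_zero]
    rw [hplus, h3, h1, h2, neg_add, zero_sub, neg_neg, ← Finset.sum_neg_distrib]
    congr 1
    refine Finset.sum_congr rfl fun i _ => ?_
    simp only [ghostFlow, gradTilde, eigenGrad, hact, hadj, add_zero]
    rw [hneg (MAdj k s P (P.fs i)), hneg (MAdj k s P (P.Φs i)), ker_neg_right, ker_neg_right]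
    abel
  · funext i
    change _ = -(-_ - diffAct (M k s P) _)
    rw [hact, sub_zero, neg_neg]
    rfl
  · funext i
    change _ - _ = -(_ + diffAdj (M k s P) _)
    rw [hadj, add_zero, hneg]
    rfl
  · funext i
    change _ - _ = -(_ + diffAdj (M k s P) _)
    rw [hadj, add_zero, hneg]
    rfl
  · funext i
    change _ = -(-_ - diffAct (M k s P) _)
    rw [hact, sub_zero, neg_neg]
    rfl

/-! ### The gradient of `λ_k^s` -/

/-- The derivative of the action of `l` at `P` in the direction `V`. -/
def laxDeriv (P V : Tuple Λ N) (h : SuperFn Λ) : SuperFn Λ :=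
  diffAct V.op h + ∑ i, (kerAct (V.f i) (P.fs i) h + kerAct (P.f i) (V.fs i) h +
    (kerAct (V.Φ i) (P.Φs i) h + kerAct (P.Φ i) (V.Φs i) h))

theorem hasJet_kerAct (u u' v v' : SuperFn Λ) {F : ℂ → SuperFn Λ} {F₀ F₁ : SuperFn Λ}
    (hF : HasJet F F₀ F₁) :
    HasJet (fun ε => kerAct (u + ε • u') (v + ε • v') (F ε)) (kerAct u v F₀)
      (kerAct u v F₁ + (kerAct u' v F₀ + kerAct u v' F₀)) := by
  have h := hasJet_mul (hasJet_linear u u')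
    ((hasJet_mul (hasJet_linear v v') hF).map (DinvLin (Λ := Λ)))
  have he : u * DinvLin (v * F₁ + v' * F₀) + u' * DinvLin (v * F₀) =
      kerAct u v F₁ + (kerAct u' v F₀ + kerAct u v' F₀) := by
    rw [map_add, mul_add, add_assoc, add_comm (u * DinvLin (v' * F₀))]
    rfl
  exact he ▸ h

theorem hasJet_lax {P V : Tuple Λ N} (hP : IsPhase P) (hV : IsPhase V) {F : ℂ → SuperFn Λ}
    {F₀ F₁ : SuperFn Λ} (hF : HasJet F F₀ F₁) :
    HasJet (fun ε => lax (move P V ε) (F ε)) (lax P F₀) (lax P F₁ + laxDeriv P V F₀) := by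
  have h := (hasJet_diffAct hP.1.1 hV.1.1 hF).add (HasJet.sum Finset.univ fun i _ =>
    (hasJet_kerAct (P.f i) (V.f i) (P.fs i) (V.fs i) hF).add
      (hasJet_kerAct (P.Φ i) (V.Φ i) (P.Φs i) (V.Φs i) hF))
  rw [lax.eq_1 P F₁, laxDeriv, add_add_add_comm, ← Finset.sum_add_distrib]
  simp only [add_add_add_comm (kerAct (P.f _) (P.fs _) F₁)] at h ⊢
  exact h

/-- The product rule $\delta(l^s)=\sum_pl^{s-1-p}(\delta l)l^p$. The derivative `X` is described
only through its pairings, where the left powers of $l$ have already passed to the adjoint. -/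
theorem exists_hasJet_lax_iterate {P V : Tuple Λ N} (hP : IsPhase P) (hV : IsPhase V)
    {F : ℂ → SuperFn Λ} {F₀ F₁ : SuperFn Λ} (hF : HasJet F F₀ F₁) (s : ℕ) :
    ∃ X, HasJet (fun ε => (lax (move P V ε))^[s] (F ε)) ((lax P)^[s] F₀) X ∧
      ∀ z, pairing X z = pairing F₁ ((laxAdj P)^[s] z) + ∑ p ∈ Finset.range s,
        pairing (laxDeriv P V ((lax P)^[p] F₀)) ((laxAdj P)^[s - 1 - p] z) := by
  induction s with
  | zero => exact ⟨F₁, hF, fun z => by simp⟩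
  | succ s ih =>
    obtain ⟨X, hX, hpair⟩ := ih
    simp only [Function.iterate_succ_apply']
    refine ⟨_, hasJet_lax hP hV hX, fun z => ?_⟩
    rw [pairing_add_left, pairing_lax hP, hpair, Finset.sum_range_succ, Nat.add_sub_cancel,
      Nat.sub_self, add_assoc, ← Function.iterate_succ_apply, Function.iterate_succ_apply']
    congr 2
    refine Finset.sum_congr rfl fun p hp => ?_
    -- One more power of $l^*$ is acquired by each old term; the new term `p = s` has none. The
    -- truncated subtraction is harmless because `p < s`.
    have hps : s - p = (s - 1 - p) + 1 := by
      have := Finset.mem_range.1 hp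
      omega
    rw [hps, Function.iterate_succ_apply]

/-- Minus the contribution of `V.f i`, `V.Φs i`, `V.fs i` and `V.Φ i` to the differential of
`⟨l w, z⟩` in the direction `V`, for fixed `w` and `z`, in terms of `w D_θ⁻¹ z`. -/
def gradTerm (P V : Tuple Λ N) (w z : SuperFn Λ) (i : Fin N) : Λ :=
  pairing (V.f i) (kerAdj w z (P.fs i)) + pairing (kerAct w z (P.Φ i)) (V.Φs i) +
    pairing (kerAct w z (P.f i)) (V.fs i) + pairing (V.Φ i) (kerAdj w z (P.Φs i))

/-- The variation of $l_+$ is handled by `opPairing_ker`, the variations of the left and right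
factors of the kernels by the two exchange lemmas, each of which contributes the minus sign. -/
theorem pairing_laxDeriv {P V : Tuple Λ N} (hP : IsPhase P) (hV : IsPhase V) {n : ℤ}
    {w z : SuperFn Λ} (hw : HasParity n w) (hz : HasParity (n + 1) z) :
    pairing (laxDeriv P V w) z = opPairing (ker w z) V.op - ∑ i, gradTerm P V w z i := by
  rw [laxDeriv, pairing_add_left, pairing_diffAct hV.1.1, opPairing_ker hV.1.1, pairing_sum_left,
    sub_eq_add_neg, ← Finset.sum_neg_distrib]
  congr 1
  refine Finset.sum_congr rfl fun i _ => ?_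
  obtain ⟨hf, hΦs, hfs, hΦ⟩ := hP.2 i
  obtain ⟨hf', hΦs', hfs', hΦ'⟩ := hV.2 i
  rw [gradTerm, pairing_add_left, pairing_add_left, pairing_add_left,
    pairing_kerAct_exchange_left (V.f i) _ hw hz, pairing_kerAct_exchange_left (V.Φ i) _ hw hz,
    pairing_kerAct_exchange_right (Or.inl ⟨hf, hfs'⟩),
    pairing_kerAct_exchange_right (Or.inr ⟨hΦ, hΦs'⟩)]
  simp only [pairing_neg_left, pairing_neg_right]
  abel

/-- The variation of $l$ differs from that of $l_+$ by kernels of negative order, which are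
orthogonal to $M_k^s$. -/
theorem opPairing_M {P V : Tuple Λ N} (hV : IsPhase V) (k : Fin N) (s : ℕ) :
    opPairing (M k s P) (backlundDeriv P V).op = ∑ p ∈ Finset.range s,
      (opPairing (ker ((lax P)^[p] (P.f k)) ((laxAdj P)^[s - 1 - p] (P.fs k))) V.op +
        opPairing (ker ((lax P)^[p] (P.Φ k)) ((laxAdj P)^[s - 1 - p] (P.Φs k))) V.op) := by
  have hK : ∀ j, 0 ≤ j → (∑ i, (ker (V.f i) (P.fs i) + ker (P.f i) (V.fs i) +
      ker (V.Φ i) (P.Φs i) + ker (P.Φ i) (V.Φs i))) j = 0 := fun j hj => by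
    rw [Finset.sum_apply]
    refine Finset.sum_eq_zero fun i _ => ?_
    simp only [Pi.add_apply, ker_apply_of_nonneg _ _ hj, add_zero]
  rw [backlundDeriv, opPairing_add_right (fun j => M_apply_of_nonneg k s P) hK, M,
    opPairing_sum_left _ (fun p _ j hj => by
      simp only [Pi.add_apply, ker_apply_of_nonneg _ _ hj, add_zero]) hV.1.1]
  exact Finset.sum_congr rfl fun p _ => opPairing_add_left
    (fun j => ker_apply_of_nonneg _ _) (fun j => ker_apply_of_nonneg _ _) hV.1.1

theorem isGradient_eigenPower {P : Tuple Λ N} (hP : IsPhase P) (k : Fin N) (s : ℕ) :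
    IsGradient (eigenPower k s) P (eigenGrad k s P) := by
  refine ⟨isCovector_eigenGrad hP k s, fun V hV => ?_⟩
  obtain ⟨hf, hΦs, hfs, hΦ⟩ := hP.2 k
  obtain ⟨X, hX, hXp⟩ := exists_hasJet_lax_iterate hP hV (hasJet_linear (P.f k) (V.f k)) s
  obtain ⟨Y, hY, hYp⟩ := exists_hasJet_lax_iterate hP hV (hasJet_linear (P.Φ k) (V.Φ k)) s
  have hjet := (hX.map₂ pairingLin (hasJet_linear (P.fs k) (V.fs k))).add
    (hY.map₂ pairingLin (hasJet_linear (P.Φs k) (V.Φs k)))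
  refine hjet.hasDerivAt.congr_deriv ?_
  change pairing ((lax P)^[s] (P.f k)) (V.fs k) + pairing X (P.fs k) +
    (pairing ((lax P)^[s] (P.Φ k)) (V.Φs k) + pairing Y (P.Φs k)) = _
  have hXs : ∀ p ∈ Finset.range s, _ = _ := fun p _ => pairing_laxDeriv hP hV
    (hasParity_lax_iterate hP hf.hasParity p)
    (hasParity_laxAdj_iterate hP hfs.hasParity (s - 1 - p))
  have hYs : ∀ p ∈ Finset.range s, _ = _ := fun p _ => pairing_laxDeriv hP hV
    (hasParity_lax_iterate hP hΦ.hasParity p)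
    (hasParity_laxAdj_iterate hP (hΦs.hasParity.congr (by decide)) (s - 1 - p))
  -- The Kronecker symbols select the boundary terms, which vary $f_k,f_k^*,\Phi_k,\Phi_k^*$ at the
  -- two ends of the pairings; what remains is minus the sum over `p` of the terms supplied by
  -- `pairing_laxDeriv`.
  have hgrad : ∑ i, (pairing (V.f i) ((eigenGrad k s P).f i) +
      pairing ((eigenGrad k s P).Φs i) (V.Φs i) + pairing ((eigenGrad k s P).fs i) (V.fs i) +
      pairing (V.Φ i) ((eigenGrad k s P).Φ i)) =
      pairing (V.f k) ((laxAdj P)^[s] (P.fs k)) + pairing ((lax P)^[s] (P.Φ k)) (V.Φs k) +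
      pairing ((lax P)^[s] (P.f k)) (V.fs k) + pairing (V.Φ k) ((laxAdj P)^[s] (P.Φs k)) -
      ∑ p ∈ Finset.range s,
        (∑ i, gradTerm P V ((lax P)^[p] (P.f k)) ((laxAdj P)^[s - 1 - p] (P.fs k)) i +
          ∑ i, gradTerm P V ((lax P)^[p] (P.Φ k)) ((laxAdj P)^[s - 1 - p] (P.Φs k)) i) := by
    have hi : ∀ i, pairing (V.f i) ((eigenGrad k s P).f i) +
        pairing ((eigenGrad k s P).Φs i) (V.Φs i) + pairing ((eigenGrad k s P).fs i) (V.fs i) +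
        pairing (V.Φ i) ((eigenGrad k s P).Φ i) =
        (if i = k then pairing (V.f i) ((laxAdj P)^[s] (P.fs i)) +
          pairing ((lax P)^[s] (P.Φ i)) (V.Φs i) + pairing ((lax P)^[s] (P.f i)) (V.fs i) +
          pairing (V.Φ i) ((laxAdj P)^[s] (P.Φs i)) else 0) - ∑ p ∈ Finset.range s,
        (gradTerm P V ((lax P)^[p] (P.f k)) ((laxAdj P)^[s - 1 - p] (P.fs k)) i +
          gradTerm P V ((lax P)^[p] (P.Φ k)) ((laxAdj P)^[s - 1 - p] (P.Φs k)) i) := by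
      intro i
      simp only [eigenGrad, pairing_add_left, pairing_add_right, pairing_neg_left,
        pairing_neg_right, MAct, MAdj, pairing_sum_left, pairing_sum_right, gradTerm,
        Finset.sum_add_distrib]
      split_ifs
      · abel
      · simp only [pairing_zero_left, pairing_zero_right]
        abel
    rw [Finset.sum_congr rfl fun i _ => hi i, Finset.sum_sub_distrib, Finset.sum_ite_eq',
      if_pos (Finset.mem_univ k), Finset.sum_comm]
    simp only [Finset.sum_add_distrib]
  rw [hgrad, hXp, hYp, Finset.sum_congr rfl hXs, Finset.sum_congr rfl hYs]
  have hop := opPairing_M (P := P) hV k s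
  rw [show (eigenGrad k s P).op = M k s P from rfl, hop]
  simp only [Finset.sum_sub_distrib, Finset.sum_add_distrib]
  abel

end SuperLax

end

open SuperLax in
theorem theorem3 {Λ : Type*} [NormedRing Λ] [NormedAlgebra ℂ Λ] [CompleteSpace Λ]
    [CommSuperalgebra Λ] {N : ℕ} (k : Fin N) (s : ℕ) (P : Tuple Λ N) (hP : IsPhase P) :
    IsPhase (ghostFlow k s P) ∧
      IsGradient (eigenPower k s) P (eigenGrad k s P) ∧
      backlundDeriv P (ghostFlow k s P) = -poisson P (eigenGrad k s P) :=
  ⟨isPhase_ghostFlow hP k s, isGradient_eigenPower hP k s, backlundDeriv_ghostFlow k s P⟩
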